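/- Theorem B. Let $X$ be a sofic shift over a finite alphabet, $\sigma_X$ its shift map, and $\varphi:X\to X$ a flip for $(X,\sigma_X)$, that is, a homeomorphism with $\varphi\sigma_X=\sigma_X^{-1}\varphi$ and $\varphi^2=\mathrm{id}_X$. For $m\ge 1$ and $n\in\mathbb Z$ put $$p_m(\sigma_X)=|\{x\in X:\sigma_X^m(x)=x\}|,\qquad p_{m,n}(\sigma_X,\varphi)=|\{x\in X:\sigma_X^m(x)=\sigma_X^n\varphi(x)=x\}|.$$ For a square matrix $M$ let $\mathcal S[M]$ be the sum of its entries and $M^\Delta$ the diagonal matrix with the same diagonal as $M$. Then there are $r\ge 0$ and integer square matrices $A_k,B_k,J_k$ ($k=1,\dots,r$), for each $k$ of the same size, such that for all $m\ge 1$ $$p_m(\sigma_X)=\sum_{k=1}^r(-1)^{k+1}\operatorname{tr}(A_k^m),$$ $$p_{2m,0}(\sigma_X,\varphi)=\sum_{k=1}^r(-1)^{k+1}\mathcal S[J_k^\Delta B_k^mJ_k^\Delta],$$ $$p_{2m,1}(\sigma_X,\varphi)=\sum_{k=1}^r(-1)^{k+1}\mathcal S[(J_kA_k)^\Delta B_k^{m-1}(A_kJ_k)^\Delta],$$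 $$p_{2m-1,0}(\sigma_X,\varphi)=\sum_{k=1}^r(-1)^{k+1}\mathcal S[J_k^\Delta B_k^{m-1}(A_kJ_k)^\Delta].$$ More precisely, these matrices can be obtained as follows. There is a flip system $(Y,\sigma_Y,\psi)$ conjugate to $(X,\sigma_X,\varphi)$ (by a homeomorphism intertwining the shifts and the flips) in which $Y$ is a sofic shift over a finite alphabet $\mathcal B$ and $\psi$ is a one-block flip: $\psi(y)_i=\tau(y_{-i})$ for some $\tau:\mathcal B\to\mathcal B$ with $\tau^2=\mathrm{id}$. Let $(Y,\sigma_Y,\psi)$ be any such system. The future of a left-infinite sequence $\lambda$ of $Y$ is the set of $\rho\in Y_{[0,\infty)}$ such that $\lambda$ followed by $\rho$ is a point of $Y$; the past of a right-infinite sequence $\rho$ of $Y$ is the set of $\lambda\in Y_{(-\infty,0]}$ such that $\lambda$ followed by $\rho$ is (after a shift) a point of $Y$. Let $\Omega$ be the set of joint states of $Y$: the triples $(F,a,P)$ where $F$ is a future, $P$ is a past, $a=\rho_0$ for some $\rho\in F$ and $a=\lambda_0$ for some $\lambda\in P$. Then $\Omega$ is finite. Write $(F_1,a_1,P_1)\to(F_2,a_2,P_2)$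 if $F_2=\{\rho\in Y_{[0,\infty)}:a_1\rho\in F_1\}$ and $P_1=\{\lambda\in Y_{(-\infty,0]}:\lambda a_2\in P_2\}$ (this is Krieger's joint state chain of $Y$), and put $(F,a,P)^*=(P^*,\tau(a),F^*)$, where $F^*$ and $P^*$ arise from $F$ and $P$ by reversing each sequence about coordinate $0$ and applying $\tau$ to each symbol. Fix any linear order on $\Omega$; the sign of an injection $f$ from a subset of $\Omega$ to $\Omega$ is $\operatorname{sgn}(f)=(-1)^{N}$ with $N=|\{(s,t):s<t,\ f(t)<f(s)\}|$. Let $\Omega_k$ be the set of the $k$-element subsets of $\Omega$ all of whose elements have the same symbol $a$, and for $S,T\in\Omega_k$ let $F(S,T)$ be the set of injections $f:S\to T$ with $s\to f(s)$ for all $s\in S$. Then the formulas hold for all $m\ge1$ with $r=|\Omega|$ and the $\Omega_k\times\Omega_k$ matrices $$A_k(S,T)=\sum_{f\in F(S,T)}\operatorname{sgn}(f),\qquad B_k(S,T)=\begin{cases}1&F(S,T)\ne\emptyset\\0&\text{otherwise,}\end{cases}\qquad J_k(S,T)=\begin{cases}\operatorname{sgn}({}^*|_S)&S^*=T\\0&\text{otherwise.}\end{cases}$$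 -/

import Mathlib

universe u

open SymbolicDynamics.FullShift (Subshift)

noncomputable section

/-! ## Flip systems -/

/-- `F` is a flip for the invertible system `(X, T)`: `F T = T⁻¹ F` and `F² = id`. -/
def IsFlip {X : Type*} [TopologicalSpace X] (T F : X ≃ₜ X) : Prop :=
  (∀ x, F (T x) = T.symm (F x)) ∧ ∀ x, F (F x) = x

/-- The flip systems `(X, T, F)` and `(X', T', F')` are conjugate. -/
def FlipConjugate {X X' : Type*} [TopologicalSpace X] [TopologicalSpace X']
    (T F : X ≃ₜ X) (T' F' : X' ≃ₜ X') : Prop :=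
  ∃ θ : X ≃ₜ X', (∀ x, θ (T x) = T' (θ x)) ∧ ∀ x, θ (F x) = F' (θ x)

/-- `p_m(T)`: the number of points fixed by `T^m`. -/
def numPeriodic {X : Type*} [TopologicalSpace X] (T : X ≃ₜ X) (m : ℕ) : ℕ :=
  Set.ncard {x : X | (T ^ m) x = x}

/-- `p_{m,n}(T, F)`: the number of points fixed by both `T^m` and `T^n F`. -/
def numFlipFixed {X : Type*} [TopologicalSpace X] (T F : X ≃ₜ X) (m : ℕ) (n : ℤ) : ℕ :=
  Set.ncard {x : X | (T ^ m) x = x ∧ (T ^ n) (F x) = x}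

/-! ## Shift spaces and sofic shifts

A shift space over the finite discrete alphabet `α` is Mathlib's `Subshift α ℤ`. -/

section Shift

variable {α : Type*} [TopologicalSpace α]

theorem shift_mem (X : Subshift α ℤ) (j : ℤ) {x : ℤ → α} (hx : x ∈ X.carrier) :
    (fun i => x (i + j)) ∈ X.carrier := by
  have h := X.mapsTo j hx
  have e : SymbolicDynamics.FullShift.shift j x = fun i => x (i + j) :=
    funext fun i => congrArg x (add_comm j i)
  rwa [e] at h

theorem continuous_reindex {X : Subshift α ℤ} (g : ℤ → ℤ) :
    Continuous fun x : X.carrier => fun i => x.1 (g i) := by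
  refine continuous_pi fun i => ?_
  exact (continuous_apply (g i)).comp continuous_subtype_val

/-- The shift map `σ_X` of a shift space, `(σ x)_i = x_{i+1}`, as a homeomorphism of `X`. -/
def shiftMap (X : Subshift α ℤ) : X.carrier ≃ₜ X.carrier where
  toFun x := ⟨fun i => x.1 (i + 1), shift_mem X 1 x.2⟩
  invFun x := ⟨fun i => x.1 (i + -1), shift_mem X (-1) x.2⟩
  left_inv x := by ext i; simp
  right_inv x := by ext i; simp
  continuous_toFun := (continuous_reindex fun i => i + 1).subtype_mk _
  continuous_invFun := (continuous_reindex fun i => i + -1).subtype_mk _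

/-- `X` is sofic: it is the set of label sequences of the bi-infinite walks in a finite directed
graph with edges labelled by `α`; `E p a q` says that there is an edge from `p` to `q` with
label `a`. -/
def IsSofic (X : Subshift α ℤ) : Prop :=
  ∃ (V : Type) (_ : Finite V) (E : V → α → V → Prop),
    X.carrier = {x | ∃ v : ℤ → V, ∀ i, E (v i) (x i) (v (i + 1))}

/-- A one-block flip of `Y`, given by its symbol map `τ`: `τ² = id` and the map
`y ↦ (τ (y_{-i}))_i` sends `Y` into (hence onto) `Y`. -/
structure OneBlockFlip (Y : Subshift α ℤ) where
  symbol : α → α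
  invol : ∀ a, symbol (symbol a) = a
  maps : ∀ y ∈ Y.carrier, (fun i => symbol (y (-i))) ∈ Y.carrier

/-- The map `φ_τ`, `φ_τ(y)_i = τ(y_{-i})`, as a homeomorphism of `Y`. -/
def OneBlockFlip.flip [DiscreteTopology α] {Y : Subshift α ℤ} (τ : OneBlockFlip Y) :
    Y.carrier ≃ₜ Y.carrier where
  toFun y := ⟨fun i => τ.symbol (y.1 (-i)), τ.maps y.1 y.2⟩
  invFun y := ⟨fun i => τ.symbol (y.1 (-i)), τ.maps y.1 y.2⟩
  left_inv y := by ext i; simp [τ.invol]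
  right_inv y := by ext i; simp [τ.invol]
  continuous_toFun := Continuous.subtype_mk (continuous_pi fun i =>
    continuous_of_discreteTopology.comp
      ((continuous_apply (-i)).comp continuous_subtype_val)) _
  continuous_invFun := Continuous.subtype_mk (continuous_pi fun i =>
    continuous_of_discreteTopology.comp
      ((continuous_apply (-i)).comp continuous_subtype_val)) _

/-! ## Krieger's joint state chain

A right ray `ρ = (ρ_i)_{i ≥ 0}` is the function `n ↦ ρ_n` on `ℕ`, and a left ray
`(ℓ_i)_{i ≤ 0}` is the function `n ↦ ℓ_{-n}` on `ℕ`. -/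

/-- `X_{[0,∞)}`. -/
def rightRays (X : Subshift α ℤ) : Set (ℕ → α) :=
  {ρ | ∃ x ∈ X.carrier, ∀ n : ℕ, ρ n = x (n : ℤ)}

/-- `X_{(-∞,0]}`. -/
def leftRays (X : Subshift α ℤ) : Set (ℕ → α) :=
  {l | ∃ x ∈ X.carrier, ∀ n : ℕ, l n = x (-(n : ℤ))}

/-- The bi-infinite sequence `ℓ.ρ`: the left ray, ending at coordinate `-1`, followed by the right
ray, starting at coordinate `0`. -/
def joinRays (l ρ : ℕ → α) : ℤ → α
  | Int.ofNat n => ρ n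
  | Int.negSucc n => l n

/-- The ray `a, r_0, r_1, …`: it is `aρ` for a right ray `ρ` and `ℓa` for a left ray `ℓ`. -/
def consRay (a : α) (r : ℕ → α) : ℕ → α
  | 0 => a
  | n + 1 => r n

/-- The future of a left ray. -/
def future (X : Subshift α ℤ) (l : ℕ → α) : Set (ℕ → α) :=
  {ρ | ρ ∈ rightRays X ∧ joinRays l ρ ∈ X.carrier}

/-- The past of a right ray. -/
def past (X : Subshift α ℤ) (ρ : ℕ → α) : Set (ℕ → α) :=
  {l | l ∈ leftRays X ∧ joinRays l ρ ∈ X.carrier}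

/-- For a set `F` of right rays, `F(a) = {ρ ∈ X_{[0,∞)} : aρ ∈ F}`. -/
def followSet (X : Subshift α ℤ) (F : Set (ℕ → α)) (a : α) : Set (ℕ → α) :=
  {ρ | ρ ∈ rightRays X ∧ consRay a ρ ∈ F}

/-- For a set `P` of left rays, `P(a) = {ℓ ∈ X_{(-∞,0]} : ℓa ∈ P}`. -/
def precedeSet (X : Subshift α ℤ) (P : Set (ℕ → α)) (a : α) : Set (ℕ → α) :=
  {l | l ∈ leftRays X ∧ consRay a l ∈ P}

/-- Joint states `(F, a, P)` of a shift space: `F` is the future of a left ray, `P` is the past of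
a right ray, and `a` occurs at coordinate `0` both in a ray of `F` and in a ray of `P`. -/
@[ext]
structure JointState (X : Subshift α ℤ) where
  F : Set (ℕ → α)
  a : α
  P : Set (ℕ → α)
  F_future : ∃ l ∈ leftRays X, F = future X l
  P_past : ∃ ρ ∈ rightRays X, P = past X ρ
  a_mem_F : ∃ ρ ∈ F, ρ 0 = a
  a_mem_P : ∃ l ∈ P, l 0 = a

/-- The transitions `(F₁, a₁, P₁) → (F₂, a₂, P₂)` of the joint state chain: `F₂ = F₁(a₁)` and
`P₁ = P₂(a₂)`. This is the relation "the entry of the zero-one transition matrix is `1`". -/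
def JointState.Adj {X : Subshift α ℤ} (s t : JointState X) : Prop :=
  t.F = followSet X s.F s.a ∧ s.P = precedeSet X t.P t.a

section Star

variable {X : Subshift α ℤ} (τ : OneBlockFlip X)

/-- Reversing a ray about coordinate `0` and applying the symbol map. -/
def OneBlockFlip.starRay (r : ℕ → α) : ℕ → α := fun n => τ.symbol (r n)

theorem OneBlockFlip.starRay_starRay (r : ℕ → α) : τ.starRay (τ.starRay r) = r :=
  funext fun n => τ.invol (r n)

theorem OneBlockFlip.starRay_mem_rightRays {l : ℕ → α} (h : l ∈ leftRays X) :
    τ.starRay l ∈ rightRays X := by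
  obtain ⟨x, hx, hl⟩ := h
  exact ⟨_, τ.maps x hx, fun n => by simp [OneBlockFlip.starRay, hl]⟩

theorem OneBlockFlip.starRay_mem_leftRays {ρ : ℕ → α} (h : ρ ∈ rightRays X) :
    τ.starRay ρ ∈ leftRays X := by
  obtain ⟨x, hx, hl⟩ := h
  exact ⟨_, τ.maps x hx, fun n => by simp [OneBlockFlip.starRay, hl]⟩

theorem OneBlockFlip.join_star_mem {l ρ : ℕ → α} (h : joinRays l ρ ∈ X.carrier) :
    joinRays (τ.starRay ρ) (τ.starRay l) ∈ X.carrier := by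
  have h1 := X.mapsTo 1 (τ.maps _ h)
  have e : SymbolicDynamics.FullShift.shift (1 : ℤ)
      (fun i => τ.symbol (joinRays l ρ (-i))) = joinRays (τ.starRay ρ) (τ.starRay l) := by
    funext i
    rcases i with n | n
    · have : -((1 : ℤ) + Int.ofNat n) = Int.negSucc n := by
        rw [Int.negSucc_eq]; simp; ring
      simp only [SymbolicDynamics.FullShift.shift, this]
      rfl
    · have : -((1 : ℤ) + Int.negSucc n) = Int.ofNat n := by
        rw [Int.negSucc_eq]; simp
      simp only [SymbolicDynamics.FullShift.shift, this]
      rfl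
  rwa [e] at h1

theorem OneBlockFlip.image_future (l : ℕ → α) :
    τ.starRay '' future X l = past X (τ.starRay l) := by
  ext r
  constructor
  · rintro ⟨ρ, ⟨h1, h2⟩, rfl⟩
    exact ⟨τ.starRay_mem_leftRays h1, τ.join_star_mem h2⟩
  · rintro ⟨h1, h2⟩
    refine ⟨τ.starRay r, ⟨τ.starRay_mem_rightRays h1, ?_⟩, τ.starRay_starRay r⟩
    simpa [τ.starRay_starRay] using τ.join_star_mem h2

theorem OneBlockFlip.image_past (ρ : ℕ → α) :
    τ.starRay '' past X ρ = future X (τ.starRay ρ) := by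
  ext r
  constructor
  · rintro ⟨l, ⟨h1, h2⟩, rfl⟩
    exact ⟨τ.starRay_mem_rightRays h1, τ.join_star_mem h2⟩
  · rintro ⟨h1, h2⟩
    refine ⟨τ.starRay r, ⟨τ.starRay_mem_leftRays h1, ?_⟩, τ.starRay_starRay r⟩
    simpa [τ.starRay_starRay] using τ.join_star_mem h2

/-- The involution `(F, a, P)* = (P*, a*, F*)` of the joint states. -/
def JointState.star (s : JointState X) : JointState X where
  F := τ.starRay '' s.P
  a := τ.symbol s.a
  P := τ.starRay '' s.F
  F_future := by
    obtain ⟨ρ, h, e⟩ := s.P_past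
    exact ⟨_, τ.starRay_mem_leftRays h, by rw [e, τ.image_past]⟩
  P_past := by
    obtain ⟨l, h, e⟩ := s.F_future
    exact ⟨_, τ.starRay_mem_rightRays h, by rw [e, τ.image_future]⟩
  a_mem_F := by
    obtain ⟨l, h, e⟩ := s.a_mem_P
    exact ⟨_, ⟨l, h, rfl⟩, congrArg τ.symbol e⟩
  a_mem_P := by
    obtain ⟨ρ, h, e⟩ := s.a_mem_F
    exact ⟨_, ⟨ρ, h, rfl⟩, congrArg τ.symbol e⟩

end Star

end Shift

/-! ## Signed subset matrices of a finite labelled chain with an involution -/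

section Subsets

variable {Ω : Type*} {β : Type*}

/-- The `k`-element subsets of `Ω` on which the label map takes exactly one value. -/
abbrev LabelSets (lab : Ω → β) (k : ℕ) : Type _ :=
  {S : Finset Ω // S.card = k ∧ ∃ b, lab '' (S : Set Ω) = {b}}

instance instFintypeLabelSets [Fintype Ω] (lab : Ω → β) (k : ℕ) : Fintype (LabelSets lab k) :=
  Fintype.ofFinite _

variable [LinearOrder Ω]

/-- The sign `(-1)^N` of a function from a finite subset of `Ω` to `Ω`, where `N` is the number of
its inversions. -/
def sgnOn {S : Finset Ω} (f : S → Ω) : ℤ :=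
  (-1) ^ (Finset.univ.filter fun p : S × S => p.1 < p.2 ∧ f p.2 < f p.1).card

open Classical in
/-- `F(S₁, S₂)`: the injective maps `f : S₁ → S₂` such that `a → f(a)` is a transition for every
`a ∈ S₁`. -/
def stepMaps (Adj : Ω → Ω → Prop) (S₁ S₂ : Finset Ω) : Finset (S₁ ↪ S₂) :=
  Finset.univ.filter fun f : S₁ ↪ S₂ => ∀ a : S₁, Adj (a : Ω) (f a : Ω)

/-- The matrix `A_k`. -/
def matA (lab : Ω → β) (Adj : Ω → Ω → Prop) (k : ℕ) :
    Matrix (LabelSets lab k) (LabelSets lab k) ℤ :=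
  Matrix.of fun S₁ S₂ => ∑ f ∈ stepMaps Adj S₁.1 S₂.1, sgnOn fun a => (f a : Ω)

open Classical in
/-- The matrix `B_k`. -/
def matB (lab : Ω → β) (Adj : Ω → Ω → Prop) (k : ℕ) :
    Matrix (LabelSets lab k) (LabelSets lab k) ℤ :=
  Matrix.of fun S₁ S₂ => if (stepMaps Adj S₁.1 S₂.1).Nonempty then 1 else 0

/-- The matrix `J_k`. -/
def matJ (lab : Ω → β) (star : Ω → Ω) (k : ℕ) :
    Matrix (LabelSets lab k) (LabelSets lab k) ℤ :=
  Matrix.of fun S₁ S₂ =>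
    if S₁.1.image star = S₂.1 then sgnOn fun a : S₁.1 => star (a : Ω) else 0

end Subsets

/-! ## Matrix notation -/

/-- `M^Δ`: the diagonal part of `M`. -/
def diagPart {ι : Type*} [DecidableEq ι] (M : Matrix ι ι ℤ) : Matrix ι ι ℤ :=
  Matrix.diagonal M.diag

/-- `S[M]`: the sum of the entries of `M`. -/
def entrySum {ι : Type*} [Fintype ι] (M : Matrix ι ι ℤ) : ℤ :=
  ∑ i, ∑ j, M i j

/-! ## The matrices of the joint state chain of a one-block flip system -/

section Krieger

variable {β : Type*} [TopologicalSpace β] (Y : Subshift β ℤ) [LinearOrder (JointState Y)]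

abbrev kriegerA (k : ℕ) := matA (JointState.a (X := Y)) JointState.Adj k

abbrev kriegerB (k : ℕ) := matB (JointState.a (X := Y)) JointState.Adj k

abbrev kriegerJ {Y : Subshift β ℤ} [LinearOrder (JointState Y)] (τ : OneBlockFlip Y) (k : ℕ) :=
  matJ (JointState.a (X := Y)) (JointState.star τ) k

end Krieger

/-- `(Y, φ_τ)` is a sofic shift with a one-block flip, conjugate to the flip system
`(X, σ_X, φ)`. -/
def IsOneBlockModel {α : Type*} [TopologicalSpace α] {X : Subshift α ℤ}
    (φ : X.carrier ≃ₜ X.carrier) {β : Type*} [TopologicalSpace β] [DiscreteTopology β]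
    {Y : Subshift β ℤ} (τ : OneBlockFlip Y) : Prop :=
  IsSofic Y ∧ FlipConjugate (shiftMap Y) τ.flip (shiftMap X) φ

end

noncomputable section

/-! ## Sums over tuples and powers of matrices -/

/-! A point `y` of `Y` has a canonical lift to the joint state chain: at coordinate `i` it records
the future of the left ray, the symbol `y i`, and the past of the right ray. This lift inherits
every period and every reflection symmetry of `y` (`canonicalState_add`, `canonicalState_reflect`).
There may be other periodic lifts, and the signs serve to cancel them. Along given labels futures
propagate to the right and pasts to the left, so two periodic lifts of `y` with a transition from
one to the other at consecutive times coincide (`jointState_resolving`). In particular the lifts of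
`y` are separated by their vertices at any single time, and there are at most `|Ω|` of them.

Let `π₁`, `π₂` be symmetries acting on the fibre of lifts of `y`; both fix the canonical lift `z`.
Sum `(-1)^(|D|+1) sgn(π₁|D) sgn(π₂|D)` over all subsets `D` of the fibre, where non-invariant
restrictions count as `0`. Toggling the membership of `z` changes only the parity of `|D|`, so the
sum vanishes; the empty set contributes `-1`, hence the nonempty sets contribute `1`
(`sum_powersetCard_signed`). Summing over `y` counts the points (`signed_sum_coherentSets`).

The matrices compute the same sums. Their powers expand into sums over tuples of `k`-sets of states.
A tuple with nonzero weight continues to a periodic family of sets, and the paths inside that family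
form a set `D` of lifts of one point (`exists_coherent_of_labelSets`); conversely `D` is determined
by the sets it visits (`sum_tuples_eq_sum_coherentSets`). Between successive visited sets there is
only one step map, so the entry of `A_k` is a single sign, the product of the signs of an
enumeration of `D` at the two times. Around a period these telescope to the sign of the shift on
`D`, which gives the trace formula.

For the flip formulas, invariance under `σ^m` and `σ^n φ` amounts to invariance under the
reflections `i ↦ c - i` and `i ↦ d - i` with `c = -n`, `d = m - n`. A tuple covers a fundamental
domain of this dihedral action, and the diagonal factors at its two ends give the signs of the two
reflections on `D`. These signs do not depend on an enumeration, so in between it only matters that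
a step exists: hence `B_k` rather than `A_k`. -/

theorem sum_tuple_eq_sum_pow {ι R : Type*} [Fintype ι] [DecidableEq ι] [CommRing R]
    (M : Matrix ι ι R) (n : ℕ) (H : ι → ι → R) :
    ∑ p : Fin (n + 1) → ι, (∏ i : Fin n, M (p i.castSucc) (p i.succ)) * H (p 0) (p (Fin.last n)) =
      ∑ i, ∑ j, (M ^ n) i j * H i j := by
  induction n generalizing H with
  | zero =>
    rw [← (Equiv.funUnique (Fin 1) ι).symm.sum_comp]
    simp [Matrix.one_apply]
  | succ n ih =>
    rw [← (Fin.snocEquiv fun _ : Fin (n + 2) => ι).sum_comp, Fintype.sum_prod_type_right]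
    have key : ∀ q : Fin (n + 1) → ι,
        ∑ x, (∏ i : Fin (n + 1), M ((Fin.snocEquiv fun _ : Fin (n + 2) => ι) (x, q) i.castSucc)
            ((Fin.snocEquiv fun _ : Fin (n + 2) => ι) (x, q) i.succ)) *
          H ((Fin.snocEquiv fun _ : Fin (n + 2) => ι) (x, q) 0)
            ((Fin.snocEquiv fun _ : Fin (n + 2) => ι) (x, q) (Fin.last (n + 1))) =
        (∏ i : Fin n, M (q i.castSucc) (q i.succ)) * ∑ x, M (q (Fin.last n)) x * H (q 0) x := by
      intro q
      rw [Finset.mul_sum]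
      refine Finset.sum_congr rfl fun x _ => ?_
      rw [Fin.prod_univ_castSucc]
      have h0 : (Fin.snocEquiv fun _ : Fin (n + 2) => ι) (x, q) 0 = q 0 := by
        exact Fin.snoc_castSucc (α := fun _ : Fin (n + 2) => ι) x q 0
      have hc : ∀ i : Fin (n + 1),
          (Fin.snocEquiv fun _ : Fin (n + 2) => ι) (x, q) i.castSucc = q i := fun i => by
        simp
      have hs : ∀ i : Fin n,
          (Fin.snocEquiv fun _ : Fin (n + 2) => ι) (x, q) i.castSucc.succ = q i.succ := fun i => by
        rw [Fin.succ_castSucc, hc]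
      have hl : (Fin.snocEquiv fun _ : Fin (n + 2) => ι) (x, q) (Fin.last (n + 1)) = x := by
        simp
      rw [Fin.succ_last, hl, h0]
      simp only [hc, hs]
      ring
    rw [Finset.sum_congr rfl fun q _ => key q, ih fun i j => ∑ x, M j x * H i x]
    refine Finset.sum_congr rfl fun i _ => ?_
    simp only [Finset.mul_sum]
    rw [Finset.sum_comm]
    refine Finset.sum_congr rfl fun j _ => ?_
    rw [pow_succ, Matrix.mul_apply, Finset.sum_mul]
    exact Finset.sum_congr rfl fun x _ => by ring

theorem trace_pow_succ_eq_sum_tuple {ι R : Type*} [Fintype ι] [DecidableEq ι] [CommRing R]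
    (M : Matrix ι ι R) (n : ℕ) :
    (M ^ (n + 1)).trace =
      ∑ p : Fin (n + 1) → ι, (∏ i : Fin n, M (p i.castSucc) (p i.succ)) * M (p (Fin.last n)) (p 0) := by
  rw [sum_tuple_eq_sum_pow M n fun i j => M j i, pow_succ]
  simp [Matrix.trace, Matrix.mul_apply]

theorem entrySum_diag_mul_pow_mul_diag {ι : Type*} [Fintype ι] [DecidableEq ι]
    (L M R : Matrix ι ι ℤ) (n : ℕ) :
    entrySum (diagPart L * M ^ n * diagPart R) =
      ∑ p : Fin (n + 1) → ι, (∏ i : Fin n, M (p i.castSucc) (p i.succ)) *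
        (L (p 0) (p 0) * R (p (Fin.last n)) (p (Fin.last n))) := by
  rw [sum_tuple_eq_sum_pow M n fun i j => L i i * R j j]
  refine Finset.sum_congr rfl fun i _ => Finset.sum_congr rfl fun j _ => ?_
  simp only [diagPart, Matrix.mul_diagonal, Matrix.diagonal_mul, Matrix.diag]
  ring

/-! ## Signs -/

section Signs

variable {Ω : Type*} [LinearOrder Ω]

/-- The sign of `y - x`. -/
def cmpSign (x y : Ω) : ℤ := if x < y then 1 else if y < x then -1 else 0

/-- The sign of the permutation that sorts the tuple `e`. -/
def tupleSign {k : ℕ} (e : Fin k → Ω) : ℤ := ∏ j, ∏ i ∈ Finset.Iio j, cmpSign (e i) (e j)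

theorem tupleSign_comp_perm {k : ℕ} (e : Fin k → Ω) (π : Equiv.Perm (Fin k)) :
    tupleSign (e ∘ π) = Equiv.Perm.sign π * tupleSign e := by
  have h := π.prod_Iio_comp_eq_sign_mul_prod (R := ℤ) (f := fun i j => cmpSign (e i) (e j))
    (fun i j => by
      simp only [cmpSign]
      rcases lt_trichotomy (e i) (e j) with h | h | h
      · simp [h, h.not_gt]
      · simp [h]
      · simp [h, h.not_gt])
  simpa [tupleSign] using h

theorem tupleSign_mul_self {k : ℕ} {e : Fin k → Ω} (he : Function.Injective e) :
    tupleSign e * tupleSign e = 1 := by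
  simp only [tupleSign, ← Finset.prod_mul_distrib]
  refine Finset.prod_eq_one fun j _ => Finset.prod_eq_one fun i hi => ?_
  have hne : e i ≠ e j := fun h => (Finset.mem_Iio.1 hi).ne (he h)
  rcases lt_or_gt_of_ne hne with h | h
  · simp [cmpSign, h]
  · simp [cmpSign, h, h.not_gt]

theorem tupleSign_of_strictMono {k : ℕ} {e : Fin k → Ω} (he : StrictMono e) : tupleSign e = 1 :=
  Finset.prod_eq_one fun j _ => Finset.prod_eq_one fun i hi => by
    simp [cmpSign, he (Finset.mem_Iio.1 hi)]

theorem sgnOn_eq_tupleSign_orderIso {k : ℕ} {S : Finset Ω} (o : Fin k ≃o S) {f : S → Ω}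
    (hf : Function.Injective f) : sgnOn f = tupleSign (f ∘ o) := by
  have h1 : ∀ j, ∀ i ∈ Finset.Iio j, cmpSign ((f ∘ o) i) ((f ∘ o) j) =
      if f (o j) < f (o i) then -1 else 1 := by
    intro j i hi
    have hne : f (o i) ≠ f (o j) := fun h => (Finset.mem_Iio.1 hi).ne (o.injective (hf h))
    rcases lt_or_gt_of_ne hne with h | h
    · simp [cmpSign, h, h.not_gt]
    · simp [cmpSign, h, h.not_gt]
  rw [tupleSign, Finset.prod_congr rfl fun j _ => Finset.prod_congr rfl (h1 j),
    Finset.prod_sigma', Finset.prod_ite, Finset.prod_const, Finset.prod_const_one, mul_one, sgnOn]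
  congr 1
  refine Finset.card_bij' (fun p _ => ⟨o.symm p.2, o.symm p.1⟩) (fun x _ => (o x.2, o x.1))
    ?_ ?_ ?_ ?_
  · rintro ⟨x, y⟩ h
    simpa using h
  · rintro ⟨j, i⟩ h
    simpa using h
  · rintro ⟨x, y⟩ _
    simp
  · rintro ⟨j, i⟩ _
    simp

/-- Changing the enumeration by `σ` multiplies both tuple signs by `sgn σ`, and for the increasing
enumeration the first one is `1`. In this form the signs of successive step maps telescope. -/
theorem sgnOn_eq_tupleSign_mul {k : ℕ} {S : Finset Ω} (e : Fin k ≃ S) {f : S → Ω}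
    (hf : Function.Injective f) :
    sgnOn f = tupleSign (fun j => (e j : Ω)) * tupleSign (f ∘ e) := by
  have hk : S.card = k := by simpa using (Fintype.card_congr e).symm
  let o : Fin k ≃o S := S.orderIsoOfFin hk
  let σ : Equiv.Perm (Fin k) := e.trans o.toEquiv.symm
  have hσ : ∀ j, o (σ j) = e j := fun j => by simp [σ]
  have h1 : (fun j => (e j : Ω)) = (fun j => (o j : Ω)) ∘ σ := funext fun j => by simp [hσ]
  have h2 : f ∘ e = (f ∘ o) ∘ σ := funext fun j => by simp [hσ]
  have h3 : tupleSign (fun j => (o j : Ω)) = 1 :=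
    tupleSign_of_strictMono fun i j hij => o.strictMono hij
  rw [h1, h2, tupleSign_comp_perm, tupleSign_comp_perm, h3, sgnOn_eq_tupleSign_orderIso o hf]
  rcases Int.units_eq_one_or (Equiv.Perm.sign σ) with h | h <;> simp [h]

end Signs

/-! ## Signs of permutations restricted to finite sets -/

section RestrictSign

variable {Λ : Type*} [DecidableEq Λ]

open Classical in
/-- The sign of the restriction of `π` to `D` if `D` is invariant, and `0` otherwise. -/
def restrictSign (π : Equiv.Perm Λ) (D : Finset Λ) : ℤ :=
  if h : ∀ x, π x ∈ D ↔ x ∈ D then Equiv.Perm.sign (π.subtypePerm (p := (· ∈ D)) h) else 0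

theorem restrictSign_of_invariant {π : Equiv.Perm Λ} {D : Finset Λ} (h : ∀ x, π x ∈ D ↔ x ∈ D) :
    restrictSign π D = Equiv.Perm.sign (π.subtypePerm (p := (· ∈ D)) h) :=
  dif_pos h

theorem invariant_of_restrictSign_ne_zero {π : Equiv.Perm Λ} {D : Finset Λ}
    (h : restrictSign π D ≠ 0) : ∀ x, π x ∈ D ↔ x ∈ D := by
  by_contra h'
  exact h (dif_neg h')

theorem restrictSign_ne_zero {π : Equiv.Perm Λ} {D : Finset Λ} (h : ∀ x, π x ∈ D ↔ x ∈ D) :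
    restrictSign π D ≠ 0 := by
  rw [restrictSign_of_invariant h]
  exact Units.ne_zero _

theorem restrictSign_one (D : Finset Λ) : restrictSign 1 D = 1 := by
  rw [restrictSign_of_invariant (π := 1) fun x => Iff.rfl, Equiv.Perm.subtypePerm_one]
  simp

theorem restrictSign_empty (π : Equiv.Perm Λ) : restrictSign π ∅ = 1 := by
  have hinv : ∀ x, π x ∈ (∅ : Finset Λ) ↔ x ∈ (∅ : Finset Λ) := fun x => by simp
  have : π.subtypePerm (p := (· ∈ (∅ : Finset Λ))) hinv = 1 :=
    Equiv.ext fun x => absurd x.2 (Finset.notMem_empty _)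
  rw [restrictSign_of_invariant hinv, this]
  simp

/-- Extended by the identity to all of `Λ`, the two restrictions are the same permutation. -/
theorem restrictSign_insert [Fintype Λ] {π : Equiv.Perm Λ} {z : Λ} (hz : π z = z) {D : Finset Λ}
    (hD : z ∉ D) : restrictSign π (insert z D) = restrictSign π D := by
  have hx : ∀ x, π x = z ↔ x = z := fun x => ⟨fun h => π.injective (h.trans hz.symm), fun h => h ▸ hz⟩
  have hiff : (∀ x, π x ∈ insert z D ↔ x ∈ insert z D) ↔ ∀ x, π x ∈ D ↔ x ∈ D := by
    refine forall_congr' fun x => ?_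
    by_cases h : x = z
    · subst h; simp [hz]
    · simp [h, hx]
  by_cases h : ∀ x, π x ∈ D ↔ x ∈ D
  · rw [restrictSign_of_invariant h, restrictSign_of_invariant (hiff.2 h),
      ← Equiv.Perm.sign_ofSubtype, ← Equiv.Perm.sign_ofSubtype]
    congr 2
    ext x
    by_cases hxD : x ∈ D
    · rw [Equiv.Perm.ofSubtype_subtypePerm_of_mem _ hxD,
        Equiv.Perm.ofSubtype_subtypePerm_of_mem (p := (· ∈ insert z D)) _
          (Finset.mem_insert_of_mem hxD)]
    · rw [Equiv.Perm.ofSubtype_subtypePerm_of_not_mem _ hxD]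
      by_cases hxz : x = z
      · subst hxz
        rw [Equiv.Perm.ofSubtype_subtypePerm_of_mem (p := (· ∈ insert x D)) _
          (Finset.mem_insert_self _ _), hz]
      · rw [Equiv.Perm.ofSubtype_subtypePerm_of_not_mem (p := (· ∈ insert z D)) _ (by simp [*])]
  · rw [restrictSign, restrictSign, dif_neg h, dif_neg (mt hiff.1 h)]

/-- The terms of `D` and `insert z D` cancel: adding a common fixed point keeps both signs and
changes the parity of the cardinality. -/
theorem sum_powerset_signed_eq_zero [Fintype Λ] {π₁ π₂ : Equiv.Perm Λ} {z : Λ} (h₁ : π₁ z = z)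
    (h₂ : π₂ z = z) {s : Finset Λ} (hz : z ∈ s) :
    ∑ D ∈ s.powerset, (-1) ^ (D.card + 1) * (restrictSign π₁ D * restrictSign π₂ D) = 0 := by
  rw [← Finset.insert_erase hz, Finset.sum_powerset_insert (Finset.notMem_erase z s),
    ← Finset.sum_add_distrib]
  refine Finset.sum_eq_zero fun D hD => ?_
  have hzD : z ∉ D := fun h => Finset.notMem_erase z s (Finset.mem_powerset.1 hD h)
  rw [restrictSign_insert h₁ hzD, restrictSign_insert h₂ hzD, Finset.card_insert_of_notMem hzD]
  ring

/-- The empty set contributes `-1` to the vanishing sum over the power set. Sizes beyond `s.card`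
contribute nothing, so one bound `K` can serve all fibres. -/
theorem sum_powersetCard_signed [Fintype Λ] {π₁ π₂ : Equiv.Perm Λ} {z : Λ} (h₁ : π₁ z = z)
    (h₂ : π₂ z = z) {s : Finset Λ} (hz : z ∈ s) {K : ℕ} (hK : s.card ≤ K) :
    ∑ k ∈ Finset.Icc 1 K, (-1) ^ (k + 1) *
      ∑ D ∈ s.powersetCard k, restrictSign π₁ D * restrictSign π₂ D = 1 := by
  have h := sum_powerset_signed_eq_zero h₁ h₂ hz
  rw [Finset.sum_powerset] at h
  have e : ∀ k, ∑ D ∈ s.powersetCard k,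
      (-1) ^ (D.card + 1) * (restrictSign π₁ D * restrictSign π₂ D) =
      (-1) ^ (k + 1) * ∑ D ∈ s.powersetCard k, restrictSign π₁ D * restrictSign π₂ D := by
    intro k
    rw [Finset.mul_sum]
    refine Finset.sum_congr rfl fun D hD => ?_
    rw [(Finset.mem_powersetCard.1 hD).2]
  simp only [e] at h
  rw [Finset.sum_range_succ'] at h
  simp only [Finset.powersetCard_zero, Finset.sum_singleton, restrictSign_empty] at h
  have h3 : ∑ k ∈ Finset.Icc 1 K, (-1 : ℤ) ^ (k + 1) *
      ∑ D ∈ s.powersetCard k, restrictSign π₁ D * restrictSign π₂ D =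
      ∑ k ∈ Finset.range s.card, (-1 : ℤ) ^ (k + 1 + 1) *
      ∑ D ∈ s.powersetCard (k + 1), restrictSign π₁ D * restrictSign π₂ D := by
    rw [Finset.range_eq_Ico, Finset.sum_Ico_add' (fun k => (-1 : ℤ) ^ (k + 1) *
      ∑ D ∈ s.powersetCard k, restrictSign π₁ D * restrictSign π₂ D) 0 s.card 1]
    symm
    refine Finset.sum_subset (fun k hk => ?_) fun k hk hk' => ?_
    · simp only [Finset.mem_Ico, Finset.mem_Icc] at hk ⊢
      omega
    · simp only [Finset.mem_Ico, Finset.mem_Icc] at hk hk'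
      rw [Finset.powersetCard_eq_empty.2 (by omega)]
      simp
  rw [h3]
  exact add_neg_eq_zero.1 (by simpa using h)

end RestrictSign

/-! ## Periodic paths of a finite labelled chain -/

section Paths

variable {Ω : Type*} {β : Type*}

/-- The periodic bi-infinite paths whose label sequence belongs to `P`. -/
def periodicPaths (lab : Ω → β) (Adj : Ω → Ω → Prop) (P : Set (ℤ → β)) : Set (ℤ → Ω) :=
  {v | (∀ i, Adj (v i) (v (i + 1))) ∧ (∃ p : ℤ, 0 < p ∧ ∀ i, v (i + p) = v i) ∧
    (fun i => lab (v i)) ∈ P}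

/-- Two periodic paths with the same labels coincide as soon as there is a transition from one to
the other between consecutive coordinates. -/
def Resolving (lab : Ω → β) (Adj : Ω → Ω → Prop) : Prop :=
  ∀ v w : ℤ → Ω, v ∈ periodicPaths lab Adj Set.univ → w ∈ periodicPaths lab Adj Set.univ →
    (∀ i, lab (v i) = lab (w i)) → ∀ i, Adj (v i) (w (i + 1)) → v = w

/-- The label sequence of a path. -/
def pathLabel {lab : Ω → β} {Adj : Ω → Ω → Prop} {P : Set (ℤ → β)}
    (v : periodicPaths lab Adj P) : ℤ → β := fun i => lab (v.1 i)

variable {lab : Ω → β} {Adj : Ω → Ω → Prop} {P : Set (ℤ → β)}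

theorem pathLabel_mem (v : periodicPaths lab Adj P) : pathLabel v ∈ P := v.2.2.2

theorem Resolving.eq_of_adj (hres : Resolving lab Adj) {v w : periodicPaths lab Adj P}
    (h : pathLabel v = pathLabel w) {i : ℤ} (hi : Adj (v.1 i) (w.1 (i + 1))) : v = w :=
  Subtype.ext <| hres _ _ ⟨v.2.1, v.2.2.1, trivial⟩ ⟨w.2.1, w.2.2.1, trivial⟩ (congrFun h) i hi

/-- If `v` and `w` meet at time `i`, the next step of `w` is also a transition from `v`. -/
theorem Resolving.eq_of_apply_eq (hres : Resolving lab Adj) {v w : periodicPaths lab Adj P}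
    (h : pathLabel v = pathLabel w) {i : ℤ} (hi : v.1 i = w.1 i) : v = w :=
  hres.eq_of_adj h (i := i) (hi ▸ w.2.1 i)

theorem apply_emod_of_periodic {γ : Type*} {y : ℤ → γ} {N : ℤ} (hy : ∀ i, y (i + N) = y i)
    (i : ℤ) : y (i % N) = y i := by
  have h : Function.Periodic y N := hy
  have := h.int_mul (i / N) (i % N)
  rw [← this]
  congr 1
  have := Int.emod_add_mul_ediv i N
  simp only [Int.cast_id]
  linarith [mul_comm N (i / N)]

/-- Only the labels have period `N`, not the paths. Agreement on `0, …, N - 1` forces equal labels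
everywhere, and then the common vertex at time `0` forces equality. -/
theorem finite_periodicPaths [Finite Ω] (hres : Resolving lab Adj) {N : ℕ} (hN : 0 < N)
    (hP : ∀ y ∈ P, ∀ i, y (i + N) = y i) : Finite (periodicPaths lab Adj P) := by
  refine Finite.of_injective (β := Fin N → Ω) (fun v j => v.1 (j : ℕ)) fun v w h => ?_
  have hN' : (0 : ℤ) < N := by exact_mod_cast hN
  have h1 : ∀ i : ℤ, 0 ≤ i → i < N → v.1 i = w.1 i := by
    intro i h0 h1
    lift i to ℕ using h0
    exact congrFun h ⟨i, by exact_mod_cast h1⟩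
  refine hres.eq_of_apply_eq (funext fun i => ?_) (h1 0 le_rfl hN')
  rw [← apply_emod_of_periodic (hP _ (pathLabel_mem v)) i,
    ← apply_emod_of_periodic (hP _ (pathLabel_mem w)) i]
  exact congrArg lab (h1 _ (Int.emod_nonneg _ hN'.ne') (Int.emod_lt_of_pos _ hN'))

/-- Reindexing the coordinates of paths by a shift. -/
def shiftPerm (lab : Ω → β) (Adj : Ω → Ω → Prop) {P : Set (ℤ → β)} (N : ℤ)
    (hP : ∀ y ∈ P, ∀ i, y (i + N) = y i) :
    Equiv.Perm (periodicPaths lab Adj P) where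
  toFun v := ⟨fun i => v.1 (i + N), by
    obtain ⟨v, h1, ⟨p, hp, h2⟩, h3⟩ := v
    refine ⟨fun i => ?_, ⟨p, hp, fun i => ?_⟩, ?_⟩
    · simpa only [add_right_comm] using h1 (i + N)
    · simpa only [add_right_comm] using h2 (i + N)
    · have : (fun i => lab (v (i + N))) = fun i => lab (v i) := funext fun i => hP _ h3 i
      show (fun i => lab (v (i + N))) ∈ P
      rwa [this]⟩
  invFun v := ⟨fun i => v.1 (i - N), by
    obtain ⟨v, h1, ⟨p, hp, h2⟩, h3⟩ := v
    refine ⟨fun i => ?_, ⟨p, hp, fun i => ?_⟩, ?_⟩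
    · simpa only [add_sub_right_comm] using h1 (i - N)
    · simpa only [add_sub_right_comm] using h2 (i - N)
    · have : (fun i => lab (v (i - N))) = fun i => lab (v i) := funext fun i => by
        simpa using (hP _ h3 (i - N)).symm
      show (fun i => lab (v (i - N))) ∈ P
      rwa [this]⟩
  left_inv v := by ext i; simp
  right_inv v := by ext i; simp

theorem shiftPerm_apply {N : ℤ} (hP : ∀ y ∈ P, ∀ i, y (i + N) = y i)
    (v : periodicPaths lab Adj P) (i : ℤ) : (shiftPerm lab Adj N hP v).1 i = v.1 (i + N) := rfl

/-- The reflection `v ↦ (v_{c-i}*)_i` of paths. -/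
def reflectPerm (lab : Ω → β) (Adj : Ω → Ω → Prop) {P : Set (ℤ → β)} {star : Ω → Ω} {τ : β → β}
    (hstar : ∀ s, star (star s) = s) (hlab : ∀ s, lab (star s) = τ (lab s))
    (hadj : ∀ s t, Adj s t → Adj (star t) (star s)) (c : ℤ)
    (hP : ∀ y ∈ P, ∀ i, y (c - i) = τ (y i)) :
    Equiv.Perm (periodicPaths lab Adj P) where
  toFun v := ⟨fun i => star (v.1 (c - i)), by
    obtain ⟨v, h1, ⟨p, hp, h2⟩, h3⟩ := v
    refine ⟨fun i => ?_, ⟨p, hp, fun i => ?_⟩, ?_⟩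
    · simpa [sub_add_eq_sub_sub] using hadj _ _ (h1 (c - i - 1))
    · have := h2 (c - i - p)
      simp only [sub_add_cancel] at this
      simp only [sub_add_eq_sub_sub, this]
    · have : (fun i => lab (star (v (c - i)))) = fun i => lab (v i) := funext fun i => by
        have := hP _ h3 (c - i)
        simp only [sub_sub_cancel] at this
        rw [hlab, this]
      show (fun i => lab (star (v (c - i)))) ∈ P
      rwa [this]⟩
  invFun v := ⟨fun i => star (v.1 (c - i)), by
    obtain ⟨v, h1, ⟨p, hp, h2⟩, h3⟩ := v
    refine ⟨fun i => ?_, ⟨p, hp, fun i => ?_⟩, ?_⟩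
    · simpa [sub_add_eq_sub_sub] using hadj _ _ (h1 (c - i - 1))
    · have := h2 (c - i - p)
      simp only [sub_add_cancel] at this
      simp only [sub_add_eq_sub_sub, this]
    · have : (fun i => lab (star (v (c - i)))) = fun i => lab (v i) := funext fun i => by
        have := hP _ h3 (c - i)
        simp only [sub_sub_cancel] at this
        rw [hlab, this]
      show (fun i => lab (star (v (c - i)))) ∈ P
      rwa [this]⟩
  left_inv v := by ext i; simp [hstar]
  right_inv v := by ext i; simp [hstar]

theorem reflectPerm_apply {star : Ω → Ω} {τ : β → β}
    (hstar : ∀ s, star (star s) = s) (hlab : ∀ s, lab (star s) = τ (lab s))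
    (hadj : ∀ s t, Adj s t → Adj (star t) (star s)) {c : ℤ}
    (hP : ∀ y ∈ P, ∀ i, y (c - i) = τ (y i)) (v : periodicPaths lab Adj P) (i : ℤ) :
    (reflectPerm lab Adj hstar hlab hadj c hP v).1 i = star (v.1 (c - i)) := rfl

/-! ### Families of sets of paths with a common label sequence -/

section Coherent

variable [Fintype (periodicPaths lab Adj P)]

open Classical in
/-- The `k`-element sets of paths that have a common label sequence. -/
def coherentSets (lab : Ω → β) (Adj : Ω → Ω → Prop) (P : Set (ℤ → β))
    [Fintype (periodicPaths lab Adj P)] (k : ℕ) : Finset (Finset (periodicPaths lab Adj P)) :=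
  (Finset.univ.image (pathLabel (lab := lab) (Adj := Adj) (P := P))).biUnion fun y =>
    (Finset.univ.filter fun v => pathLabel v = y).powersetCard k

/-- For `k ≠ 0` an element of `D` supplies the common label sequence. -/
theorem mem_coherentSets {k : ℕ} (hk : k ≠ 0) {D : Finset (periodicPaths lab Adj P)} :
    D ∈ coherentSets lab Adj P k ↔
      D.card = k ∧ ∀ v ∈ D, ∀ w ∈ D, pathLabel v = pathLabel w := by
  classical
  simp only [coherentSets, Finset.mem_biUnion, Finset.mem_image, Finset.mem_univ, true_and,
    Finset.mem_powersetCard, exists_exists_eq_and]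
  constructor
  · rintro ⟨u, h1, h2⟩
    refine ⟨h2, fun v hv w hw => ?_⟩
    have hv := h1 hv
    have hw := h1 hw
    simp only [Finset.mem_filter_univ] at hv hw
    rw [hv, hw]
  · rintro ⟨h1, h2⟩
    obtain ⟨u, hu⟩ := Finset.card_pos.1 (h1 ▸ Nat.pos_of_ne_zero hk)
    exact ⟨u, fun v hv => by simpa using h2 v hv u hu, h1⟩

/-- Each fibre of `pathLabel` contributes `1`. The hypothesis `hz` provides the common fixed point
in the fibre and shows that no point of `P` has an empty fibre. -/
theorem signed_sum_coherentSets [Fintype Ω] [DecidableEq (periodicPaths lab Adj P)]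
    (hres : Resolving lab Adj) (π₁ π₂ : Equiv.Perm (periodicPaths lab Adj P))
    (hz : ∀ y ∈ P, ∃ z : periodicPaths lab Adj P, pathLabel z = y ∧ π₁ z = z ∧ π₂ z = z) :
    ∑ k ∈ Finset.Icc 1 (Fintype.card Ω), (-1) ^ (k + 1) *
      ∑ D ∈ coherentSets lab Adj P k, restrictSign π₁ D * restrictSign π₂ D = (P.ncard : ℤ) := by
  classical
  have hP : P = ((Finset.univ.image (pathLabel (lab := lab) (Adj := Adj) (P := P)) : Finset _) :
      Set (ℤ → β)) := by
    ext y
    simp only [Finset.coe_image, Finset.coe_univ, Set.image_univ, Set.mem_range]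
    exact ⟨fun h => (hz y h).imp fun z hz => hz.1, fun ⟨v, hv⟩ => hv ▸ pathLabel_mem v⟩
  rw [show (P.ncard : ℤ) =
    ∑ y ∈ Finset.univ.image (pathLabel (lab := lab) (Adj := Adj) (P := P)), 1 by
      conv_lhs => rw [hP]
      rw [Set.ncard_coe_finset]; simp]
  have hdisj : ∀ k ∈ Finset.Icc 1 (Fintype.card Ω), ∑ D ∈ coherentSets lab Adj P k,
      restrictSign π₁ D * restrictSign π₂ D =
      ∑ y ∈ Finset.univ.image (pathLabel (lab := lab) (Adj := Adj) (P := P)),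
        ∑ D ∈ (Finset.univ.filter fun v : periodicPaths lab Adj P =>
          pathLabel v = y).powersetCard k, restrictSign π₁ D * restrictSign π₂ D := by
    intro k hk
    have hc : coherentSets lab Adj P k =
        (Finset.univ.image (pathLabel (lab := lab) (Adj := Adj) (P := P))).biUnion fun y =>
          (Finset.univ.filter fun v => pathLabel v = y).powersetCard k := by
      ext D
      simp [coherentSets]
    rw [hc]
    -- Since `k ≥ 1`, a set `D` contains a path, whose label determines the fibre.
    refine Finset.sum_biUnion ?_
    intro y _ y' _ hne
    refine Finset.disjoint_left.2 fun D hD hD' => hne ?_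
    rw [Finset.mem_powersetCard] at hD hD'
    obtain ⟨v, hv⟩ := Finset.card_pos.1 (hD.2 ▸ (Finset.mem_Icc.1 hk).1)
    have h1 := hD.1 hv
    have h2 := hD'.1 hv
    simp only [Finset.mem_filter_univ] at h1 h2
    rw [← h1, h2]
  rw [Finset.sum_congr rfl fun k hk => by rw [hdisj k hk, Finset.mul_sum], Finset.sum_comm]
  refine Finset.sum_congr rfl fun y hy => ?_
  have hyP : y ∈ P := by
    rw [hP]; exact hy
  obtain ⟨z, h0, h1, h2⟩ := hz y hyP
  refine sum_powersetCard_signed h1 h2 (by simpa using h0) ?_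
  -- Paths in one fibre have different vertices at time `0`, so the fibre has at most `card Ω`
  -- elements.
  rw [← Finset.card_univ (α := Ω)]
  refine Finset.card_le_card_of_injOn (fun v => v.1 0) (fun _ _ => Finset.mem_coe.2 (Finset.mem_univ _)) ?_
  intro v hv w hw h
  simp only [Finset.coe_filter, Finset.mem_univ, true_and, Set.mem_ofPred_eq] at hv hw
  exact hres.eq_of_apply_eq (hv.trans hw.symm) h

end Coherent

/-- The set of vertices visited at time `i` by a set of paths. -/
def visited [DecidableEq Ω] (D : Finset (periodicPaths lab Adj P)) (i : ℤ) : Finset Ω :=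
  D.image fun v => v.1 i

theorem mem_visited [DecidableEq Ω] {D : Finset (periodicPaths lab Adj P)} {i : ℤ} {s : Ω} :
    s ∈ visited D i ↔ ∃ v ∈ D, v.1 i = s := by
  simp [visited]

/-- The correspondence sends `D` to the sets it visits at times `0, …, n`. It is injective because
the labels at these times determine the point, and a path is then determined by its vertex at time
`0`. Bijectivity is needed only on nonzero terms. -/
theorem sum_tuples_eq_sum_coherentSets [DecidableEq Ω] [Fintype Ω]
    [Fintype (periodicPaths lab Adj P)] (hres : Resolving lab Adj) {k : ℕ} (hk : k ≠ 0) {n : ℕ}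
    (hP : ∀ y ∈ P, ∀ y' ∈ P, (∀ i : ℕ, i ≤ n → y i = y' i) → y = y')
    (T : (Fin (n + 1) → LabelSets lab k) → ℤ) (val : Finset (periodicPaths lab Adj P) → ℤ)
    (hval : ∀ D ∈ coherentSets lab Adj P k, val D ≠ 0 → ∀ p : Fin (n + 1) → LabelSets lab k,
      (∀ i, (p i).1 = visited D (i : ℕ)) → T p = val D)
    (hsurj : ∀ p, T p ≠ 0 → ∃ D ∈ coherentSets lab Adj P k, val D ≠ 0 ∧
      ∀ i, (p i).1 = visited D (i : ℕ)) :
    ∑ p, T p = ∑ D ∈ coherentSets lab Adj P k, val D := by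
  have hset : ∀ D ∈ coherentSets lab Adj P k, ∀ i : ℤ, (visited D i).card = k ∧
      ∃ b, lab '' (visited D i : Set Ω) = {b} := by
    intro D hD i
    obtain ⟨h1, h2⟩ := (mem_coherentSets hk).1 hD
    constructor
    · rw [visited, Finset.card_image_of_injOn, h1]
      exact fun v hv w hw h => hres.eq_of_apply_eq (h2 v hv w hw) h
    · obtain ⟨u, hu⟩ := Finset.card_pos.1 (h1 ▸ Nat.pos_of_ne_zero hk)
      refine ⟨lab (u.1 i), Set.eq_singleton_iff_unique_mem.2
        ⟨⟨_, mem_visited.2 ⟨u, hu, rfl⟩, rfl⟩, ?_⟩⟩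
      rintro _ ⟨s, hs, rfl⟩
      obtain ⟨v, hv, rfl⟩ := mem_visited.1 hs
      exact congrFun (h2 v hv u hu) i
  symm
  refine Finset.sum_bij_ne_zero (fun D hD _ => fun i : Fin (n + 1) => ⟨visited D (i : ℕ), hset D hD _⟩)
    (fun _ _ _ => Finset.mem_univ _) ?_ ?_ fun D hD h => (hval D hD h _ fun i => rfl).symm
  · intro D hD _ D' hD' _ h
    have hv : ∀ i : ℕ, i ≤ n → visited D i = visited D' i := fun i hi =>
      congrArg Subtype.val (congrFun h ⟨i, Nat.lt_succ_of_le hi⟩)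
    obtain ⟨h1, h2⟩ := (mem_coherentSets hk).1 hD
    obtain ⟨h1', h2'⟩ := (mem_coherentSets hk).1 hD'
    have hlab : ∀ v ∈ D, ∀ w ∈ D', pathLabel v = pathLabel w := by
      intro v hvD w hwD
      refine hP _ (pathLabel_mem v) _ (pathLabel_mem w) fun i hi => ?_
      have : v.1 i ∈ visited D' i := hv i hi ▸ mem_visited.2 ⟨v, hvD, rfl⟩
      obtain ⟨u, hu, hui⟩ := mem_visited.1 this
      rw [← h2' u hu w hwD]
      exact congrArg lab hui.symm
    refine Finset.eq_of_subset_of_card_le (fun v hvD => ?_) (by rw [h1, h1'])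
    have : v.1 (0 : ℕ) ∈ visited D' (0 : ℕ) := hv 0 (Nat.zero_le _) ▸ mem_visited.2 ⟨v, hvD, rfl⟩
    obtain ⟨u, hu, hui⟩ := mem_visited.1 this
    rwa [← hres.eq_of_apply_eq (hlab v hvD u hu).symm hui]
  · intro p _ hp
    obtain ⟨D, hD, h1, h2⟩ := hsurj p hp
    exact ⟨D, hD, h1, funext fun i => Subtype.ext (h2 i).symm⟩

end Paths

/-! ### Matrix entries at the sets visited by a family of paths -/

section Evaluation

variable {Ω : Type*} {β : Type*} [LinearOrder Ω] {lab : Ω → β} {Adj : Ω → Ω → Prop}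
  {P : Set (ℤ → β)}

theorem tupleSign_apply_perm {Λ : Type*} [DecidableEq Λ] {π : Equiv.Perm Λ} {D : Finset Λ}
    (h : ∀ x, π x ∈ D ↔ x ∈ D) {k : ℕ} (e : Fin k ≃ D) (x : Λ → Ω) :
    tupleSign (fun j => x (π (e j))) = restrictSign π D * tupleSign fun j => x (e j) := by
  have h1 : (fun j => x (π (e j))) =
      (fun j => x (e j)) ∘ e.symm.permCongr (π.subtypePerm (p := (· ∈ D)) h) := by
    funext j
    simp [Equiv.permCongr_apply]
  rw [h1, tupleSign_comp_perm, Equiv.Perm.sign_permCongr, restrictSign_of_invariant h]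

/-- The enumeration of the visited vertices induced by an enumeration of the paths. -/
def visitedEquiv (hres : Resolving lab Adj) {D : Finset (periodicPaths lab Adj P)}
    (hD : ∀ v ∈ D, ∀ w ∈ D, pathLabel v = pathLabel w) (i : ℤ) : D ≃ visited D i :=
  Equiv.ofBijective (fun v => ⟨v.1.1 i, mem_visited.2 ⟨v.1, v.2, rfl⟩⟩)
    ⟨fun v w h => Subtype.ext <|
      hres.eq_of_apply_eq (hD _ v.2 _ w.2) (congrArg Subtype.val h),
    fun s => by
      obtain ⟨v, hv, h⟩ := mem_visited.1 s.2
      exact ⟨⟨v, hv⟩, Subtype.ext h⟩⟩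

theorem visitedEquiv_apply (hres : Resolving lab Adj) {D : Finset (periodicPaths lab Adj P)}
    (hD : ∀ v ∈ D, ∀ w ∈ D, pathLabel v = pathLabel w) (i : ℤ) (v : D) :
    (visitedEquiv hres hD i v : Ω) = v.1.1 i := rfl

theorem tupleSign_visited_mul_self (hres : Resolving lab Adj)
    {D : Finset (periodicPaths lab Adj P)}
    (hD : ∀ v ∈ D, ∀ w ∈ D, pathLabel v = pathLabel w) {k : ℕ} (e : Fin k ≃ D) (i : ℤ) :
    tupleSign (fun j => (e j).1.1 i) * tupleSign (fun j => (e j).1.1 i) = 1 :=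
  tupleSign_mul_self fun _ _ h => e.injective <| Subtype.ext <|
    hres.eq_of_apply_eq (hD _ (e _).2 _ (e _).2) h

/-- A step map sends the vertex of `v` at time `i` to the vertex of some `w` in `D` at time `i + 1`;
that transition forces `v = w`. So following the paths is the only step map. -/
theorem stepMaps_visited (hres : Resolving lab Adj) {D : Finset (periodicPaths lab Adj P)}
    (hD : ∀ v ∈ D, ∀ w ∈ D, pathLabel v = pathLabel w) (i : ℤ) :
    stepMaps Adj (visited D i) (visited D (i + 1)) =
      {((visitedEquiv hres hD i).symm.trans (visitedEquiv hres hD (i + 1))).toEmbedding} := by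
  ext f
  simp only [stepMaps, Finset.mem_filter, Finset.mem_univ, true_and, Finset.mem_singleton]
  constructor
  · intro hf
    ext s
    obtain ⟨v, rfl⟩ := (visitedEquiv hres hD i).surjective s
    obtain ⟨w, hw⟩ := (visitedEquiv hres hD (i + 1)).surjective (f (visitedEquiv hres hD i v))
    have h := hf (visitedEquiv hres hD i v)
    rw [← hw] at h
    have : v = w := Subtype.ext (hres.eq_of_adj (hD _ v.2 _ w.2) h)
    subst this
    simp [← hw]
  · rintro rfl s
    obtain ⟨v, rfl⟩ := (visitedEquiv hres hD i).surjective s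
    simpa [visitedEquiv_apply] using v.1.2.1 i

theorem matB_visited (hres : Resolving lab Adj) {D : Finset (periodicPaths lab Adj P)}
    (hD : ∀ v ∈ D, ∀ w ∈ D, pathLabel v = pathLabel w) {k : ℕ} {i : ℤ} {p q : LabelSets lab k}
    (hp : p.1 = visited D i) (hq : q.1 = visited D (i + 1)) : matB lab Adj k p q = 1 := by
  rw [matB, Matrix.of_apply, hp, hq, stepMaps_visited hres hD]
  simp

theorem matA_visited (hres : Resolving lab Adj) {D : Finset (periodicPaths lab Adj P)}
    (hD : ∀ v ∈ D, ∀ w ∈ D, pathLabel v = pathLabel w) {k : ℕ} (e : Fin k ≃ D) {i : ℤ}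
    {p q : LabelSets lab k} (hp : p.1 = visited D i) (hq : q.1 = visited D (i + 1)) :
    matA lab Adj k p q =
      tupleSign (fun j => (e j).1.1 i) * tupleSign fun j => (e j).1.1 (i + 1) := by
  rw [matA, Matrix.of_apply, hp, hq, stepMaps_visited hres hD, Finset.sum_singleton,
    sgnOn_eq_tupleSign_mul (e.trans (visitedEquiv hres hD i))]
  · congr 2
    funext j
    simp [visitedEquiv_apply]
  · exact Subtype.val_injective.comp (Equiv.injective _)

theorem image_star_visited {star : Ω → Ω} {τ : β → β}
    (hstar : ∀ s, star (star s) = s) (hlab : ∀ s, lab (star s) = τ (lab s))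
    (hadj : ∀ s t, Adj s t → Adj (star t) (star s)) {c : ℤ}
    (hP : ∀ y ∈ P, ∀ i, y (c - i) = τ (y i)) {D : Finset (periodicPaths lab Adj P)}
    (hinv : ∀ x, reflectPerm lab Adj hstar hlab hadj c hP x ∈ D ↔ x ∈ D)
    {i i' : ℤ} (hi : i + i' = c) : (visited D i).image star = visited D i' := by
  have hval : ∀ v : periodicPaths lab Adj P,
      (reflectPerm lab Adj hstar hlab hadj c hP v).1 i' = star (v.1 i) := fun v => by
    have : c - i' = i := by omega
    rw [reflectPerm_apply, this]
  ext s
  simp only [Finset.mem_image, mem_visited]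
  constructor
  · rintro ⟨_, ⟨v, hv, rfl⟩, rfl⟩
    exact ⟨_, (hinv v).2 hv, hval v⟩
  · rintro ⟨v, hv, rfl⟩
    obtain ⟨w, rfl⟩ := (reflectPerm lab Adj hstar hlab hadj c hP).surjective v
    exact ⟨_, ⟨w, (hinv w).1 hv, rfl⟩, (hval w).symm⟩

/-- The involution carries the vertex of a path at time `i` to the vertex of the reflected path at
time `i' = c - i`. Its sign therefore compares the enumerations at the two times, up to the
permutation of `D` by the reflection. -/
theorem matJ_visited {star : Ω → Ω} {τ : β → β}
    (hstar : ∀ s, star (star s) = s) (hlab : ∀ s, lab (star s) = τ (lab s))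
    (hadj : ∀ s t, Adj s t → Adj (star t) (star s)) {c : ℤ}
    (hP : ∀ y ∈ P, ∀ i, y (c - i) = τ (y i)) [DecidableEq (periodicPaths lab Adj P)]
    (hres : Resolving lab Adj) {D : Finset (periodicPaths lab Adj P)}
    (hD : ∀ v ∈ D, ∀ w ∈ D, pathLabel v = pathLabel w)
    (hinv : ∀ x, reflectPerm lab Adj hstar hlab hadj c hP x ∈ D ↔ x ∈ D)
    {k : ℕ} (e : Fin k ≃ D) {i i' : ℤ} (hi : i + i' = c) {p q : LabelSets lab k}
    (hp : p.1 = visited D i) (hq : q.1 = visited D i') :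
    matJ lab star k p q =
      tupleSign (fun j => (e j).1.1 i) * (tupleSign (fun j => (e j).1.1 i') *
        restrictSign (reflectPerm lab Adj hstar hlab hadj c hP) D) := by
  have hval : ∀ v : periodicPaths lab Adj P,
      (reflectPerm lab Adj hstar hlab hadj c hP v).1 i' = star (v.1 i) := fun v => by
    have : c - i' = i := by omega
    rw [reflectPerm_apply, this]
  rw [matJ, Matrix.of_apply, hp, hq, if_pos (image_star_visited hstar hlab hadj hP hinv hi),
    sgnOn_eq_tupleSign_mul (e.trans (visitedEquiv hres hD i)), mul_comm (tupleSign fun j => (e j).1.1 i'),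
    ← tupleSign_apply_perm hinv e fun v => v.1 i']
  · congr 2
    funext j
    simp [visitedEquiv_apply, hval]
  · exact (Function.LeftInverse.injective hstar).comp Subtype.val_injective

theorem image_star_labelSets {star : Ω → Ω} {τ : β → β}
    (hstar : ∀ s, star (star s) = s) (hlab : ∀ s, lab (star s) = τ (lab s)) {k : ℕ}
    (p : LabelSets lab k) :
    (p.1.image star).card = k ∧ ∃ b, lab '' (p.1.image star : Set Ω) = {b} := by
  obtain ⟨S, h, b, hb⟩ := p
  refine ⟨by rw [Finset.card_image_of_injective _ (Function.LeftInverse.injective hstar), h],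
    τ b, ?_⟩
  rw [Finset.coe_image, Set.image_image]
  simp only [hlab]
  rw [← Set.image_image τ lab, hb, Set.image_singleton]

/-- The set `S* = {s* : s ∈ S}`. -/
def starSet {star : Ω → Ω} {τ : β → β}
    (hstar : ∀ s, star (star s) = s) (hlab : ∀ s, lab (star s) = τ (lab s)) {k : ℕ}
    (p : LabelSets lab k) : LabelSets lab k := ⟨p.1.image star, image_star_labelSets hstar hlab p⟩

/-- A row of `matJ` has a single nonzero entry, so the product collapses to one term. -/
theorem matJ_mul_matA_apply [Fintype Ω] {star : Ω → Ω} {τ : β → β}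
    (hstar : ∀ s, star (star s) = s) (hlab : ∀ s, lab (star s) = τ (lab s)) {k : ℕ}
    (p q : LabelSets lab k) :
    (matJ lab star k * matA lab Adj k) p q =
      matJ lab star k p (starSet hstar hlab p) * matA lab Adj k (starSet hstar hlab p) q := by
  rw [Matrix.mul_apply]
  refine Finset.sum_eq_single _ (fun r _ hr => ?_) fun h => absurd (Finset.mem_univ _) h
  rw [matJ, Matrix.of_apply, if_neg fun h => hr (Subtype.ext h.symm), zero_mul]

theorem matA_mul_matJ_apply [Fintype Ω] {star : Ω → Ω} {τ : β → β}
    (hstar : ∀ s, star (star s) = s) (hlab : ∀ s, lab (star s) = τ (lab s)) {k : ℕ}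
    (p q : LabelSets lab k) :
    (matA lab Adj k * matJ lab star k) p q =
      matA lab Adj k p (starSet hstar hlab q) * matJ lab star k (starSet hstar hlab q) q := by
  rw [Matrix.mul_apply]
  refine Finset.sum_eq_single _ (fun r _ hr => ?_) fun h => absurd (Finset.mem_univ _) h
  rw [matJ, Matrix.of_apply, if_neg, mul_zero]
  rintro h
  refine hr (Subtype.ext (?_ : r.1 = q.1.image star))
  rw [← h, Finset.image_image]
  simp [Function.comp_def, hstar]

end Evaluation

/-! ### Paths through a periodic family of sets -/

section Families

variable {Ω : Type*} {β : Type*} {lab : Ω → β} {Adj : Ω → Ω → Prop}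

/-- Choose one injective step map for each residue mod `N`. Together they give an injective self-map
of the finite disjoint union of the sets, hence a permutation `G`. Its orbits are bi-infinite paths
through any prescribed vertex; their period is the order of `G`, which may exceed `N`. -/
theorem exists_path_of_family {N : ℕ} (hN : 0 < N) {q : ℤ → Finset Ω}
    (hper : ∀ i, q (i + N) = q i) (hstep : ∀ i, (stepMaps Adj (q i) (q (i + 1))).Nonempty)
    {j : ℤ} {s : Ω} (hs : s ∈ q j) :
    ∃ v : ℤ → Ω, (∀ i, Adj (v i) (v (i + 1))) ∧ (∃ p : ℤ, 0 < p ∧ ∀ i, v (i + p) = v i) ∧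
      (∀ i, v i ∈ q i) ∧ v j = s := by
  have : NeZero N := ⟨hN.ne'⟩
  let q' : ZMod N → Finset Ω := fun a => q (a.val : ℤ)
  have hq' : ∀ i : ℤ, q' (i : ZMod N) = q i := fun i => by
    simp only [q', ZMod.val_intCast]
    exact apply_emod_of_periodic hper i
  have hstep' : ∀ a : ZMod N, ∃ f : q' a ↪ q' (a + 1), ∀ x : q' a, Adj (x : Ω) (f x : Ω) := by
    intro a
    obtain ⟨i, rfl⟩ := ZMod.intCast_surjective a
    have h := hstep i
    have e : ((i : ZMod N) + 1) = ((i + 1 : ℤ) : ZMod N) := by push_cast; rfl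
    rw [e, hq', hq']
    obtain ⟨f, hf⟩ := h
    exact ⟨f, by simpa [stepMaps] using hf⟩
  choose f hf using hstep'
  let g : (Σ a, q' a) → (Σ a, q' a) := fun x => ⟨x.1 + 1, f x.1 x.2⟩
  have hg : Function.Injective g := by
    rintro ⟨a, x⟩ ⟨b, y⟩ h
    simp only [g, Sigma.mk.injEq, add_left_inj] at h
    obtain ⟨rfl, h⟩ := h
    rw [(f a).injective (eq_of_heq h)]
  let G : Equiv.Perm (Σ a, q' a) := Equiv.ofBijective g (Finite.injective_iff_bijective.1 hg)
  have hG1 : ∀ x, (G x).1 = x.1 + 1 := fun x => rfl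
  have hG : ∀ (i : ℤ) x, ((G ^ i) x).1 = x.1 + i := by
    intro i
    induction i with
    | zero => intro x; simp
    | succ n ih => intro x; rw [add_comm, zpow_add, Equiv.Perm.mul_apply, zpow_one, hG1, ih]; push_cast; ring
    | pred n ih =>
      intro x
      have h := hG1 ((G ^ (-(n : ℤ) - 1)) x)
      rw [← Equiv.Perm.mul_apply, ← zpow_one_add, add_sub_cancel, ih] at h
      rw [eq_sub_of_add_eq h.symm]
      push_cast
      ring
  have hs' : s ∈ q' (j : ZMod N) := by rwa [hq']
  let x₀ : Σ a, q' a := ⟨j, s, hs'⟩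
  let ev : (Σ a, q' a) → Ω := fun x => x.2
  have hev : ∀ x b, x.1 = b → ev x ∈ q' b := by
    rintro x _ rfl
    exact x.2.2
  have hadj : ∀ x, Adj (ev x) (ev (G x)) := fun x => hf _ _
  refine ⟨fun i => ev ((G ^ (i - j)) x₀), fun i => ?_, ⟨orderOf G, ?_, fun i => ?_⟩, fun i => ?_, ?_⟩
  · have : i + 1 - j = 1 + (i - j) := by ring
    simp only [this, zpow_add, zpow_one, Equiv.Perm.mul_apply]
    exact hadj _
  · exact_mod_cast orderOf_pos G
  · have : i + (orderOf G : ℤ) - j = (i - j) + orderOf G := by ring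
    simp only [this, zpow_add, zpow_natCast, pow_orderOf_eq_one, mul_one]
  · rw [← hq' i]
    refine hev _ _ ?_
    rw [hG]
    simp [x₀]
  · simp [ev, x₀]

/-- `D` consists of all paths that stay inside the family. Any two of them have the same labels,
every vertex of the family is visited, and evaluation at time `0` is injective on `D`, so `D` has
`k` elements. -/
theorem exists_coherent_of_family [LinearOrder Ω] {P : Set (ℤ → β)}
    [Fintype (periodicPaths lab Adj P)] (hres : Resolving lab Adj) {k : ℕ} (hk : k ≠ 0)
    {N : ℕ} (hN : 0 < N) {q : ℤ → Finset Ω} (hcard : ∀ i, (q i).card = k)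
    (hlab : ∀ i, ∀ s ∈ q i, ∀ t ∈ q i, lab s = lab t)
    (hper : ∀ i, q (i + N) = q i) (hstep : ∀ i, (stepMaps Adj (q i) (q (i + 1))).Nonempty)
    (hP : ∀ v : ℤ → Ω, (∀ i, Adj (v i) (v (i + 1))) → (∀ i, v i ∈ q i) →
      (fun i => lab (v i)) ∈ P) :
    ∃ D ∈ coherentSets lab Adj P k, (∀ v, v ∈ D ↔ ∀ i, v.1 i ∈ q i) ∧ ∀ i, q i = visited D i := by
  classical
  let D : Finset (periodicPaths lab Adj P) := Finset.univ.filter fun v => ∀ i, v.1 i ∈ q i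
  have hD : ∀ v, v ∈ D ↔ ∀ i, v.1 i ∈ q i := fun v => by simp [D]
  have hcoh : ∀ v ∈ D, ∀ w ∈ D, pathLabel v = pathLabel w := fun v hv w hw =>
    funext fun i => hlab i _ ((hD v).1 hv i) _ ((hD w).1 hw i)
  have hvis : ∀ i, q i = visited D i := by
    intro i
    ext s
    rw [mem_visited]
    constructor
    · intro hs
      obtain ⟨v, h1, h2, h3, h4⟩ := exists_path_of_family hN hper hstep hs
      exact ⟨⟨v, h1, h2, hP v h1 h3⟩, (hD _).2 h3, h4⟩
    · rintro ⟨v, hv, rfl⟩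
      exact (hD v).1 hv i
  refine ⟨D, (mem_coherentSets hk).2 ⟨?_, hcoh⟩, hD, hvis⟩
  rw [← hcard 0, hvis 0, visited, Finset.card_image_of_injOn]
  exact fun v hv w hw h => hres.eq_of_apply_eq (hcoh v hv w hw) h

end Families

theorem add_one_emod_of_lt {N : ℤ} (hN : 0 < N) (i : ℤ) :
    (i % N = N - 1 ∧ (i + 1) % N = 0) ∨ (i % N < N - 1 ∧ (i + 1) % N = i % N + 1) := by
  have h0 := Int.emod_nonneg i hN.ne'
  have h1 := Int.emod_lt_of_pos i hN
  have h2 : (i + 1) % N = (i % N + 1) % N := by rw [Int.emod_add_emod]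
  rcases eq_or_lt_of_le (Int.le_sub_one_of_lt h1) with h | h
  · left
    rw [h2, h, sub_add_cancel, Int.emod_self]
    exact ⟨rfl, rfl⟩
  · right
    rw [h2, Int.emod_eq_of_lt (a := i % N + 1) (by omega) (by omega)]
    exact ⟨h, rfl⟩

theorem prod_mul_succ_eq {t : ℤ → ℤ} (ht : ∀ i, t i * t i = 1) (n : ℕ) :
    ∏ i : Fin n, (t (i : ℕ) * t ((i : ℕ) + 1)) = t 0 * t n := by
  induction n with
  | zero => simp [ht]
  | succ n ih =>
    rw [Fin.prod_univ_castSucc]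
    simp only [Fin.val_castSucc, Fin.val_last, ih]
    push_cast
    linear_combination t 0 * t (n + 1) * ht n

/-! ### From tuples of label sets to sets of paths -/

section LabelSets

variable {Ω : Type*} {β : Type*} {lab : Ω → β} {Adj : Ω → Ω → Prop}

theorem labelSets_lab_eq {k : ℕ} (p : LabelSets lab k) {s t : Ω} (hs : s ∈ p.1) (ht : t ∈ p.1) :
    lab s = lab t := by
  obtain ⟨b, hb⟩ := p.2.2
  have h : ∀ x ∈ p.1, lab x = b := fun x hx => by
    have : lab x ∈ lab '' (p.1 : Set Ω) := ⟨x, hx, rfl⟩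
    rwa [hb] at this
  rw [h s hs, h t ht]

theorem stepMaps_nonempty_of_matA_ne_zero [LinearOrder Ω] {k : ℕ} {p q : LabelSets lab k}
    (h : matA lab Adj k p q ≠ 0) : (stepMaps Adj p.1 q.1).Nonempty := by
  rw [Finset.nonempty_iff_ne_empty]
  intro he
  rw [matA, Matrix.of_apply, he, Finset.sum_empty] at h
  exact h rfl

theorem stepMaps_nonempty_of_matB_ne_zero {k : ℕ} {p q : LabelSets lab k}
    (h : matB lab Adj k p q ≠ 0) : (stepMaps Adj p.1 q.1).Nonempty := by
  by_contra he
  rw [matB, Matrix.of_apply, if_neg he] at h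
  exact h rfl

theorem exists_coherent_of_labelSets [LinearOrder Ω] {P : Set (ℤ → β)}
    [Fintype (periodicPaths lab Adj P)] (hres : Resolving lab Adj) {k : ℕ} (hk : k ≠ 0)
    {N : ℕ} (hN : 0 < N) (q : ℤ → LabelSets lab k) (hper : ∀ i, q (i + N) = q i)
    (hstep : ∀ i, (stepMaps Adj (q i).1 (q (i + 1)).1).Nonempty)
    (hP : ∀ v : ℤ → Ω, (∀ i, Adj (v i) (v (i + 1))) → (∀ i, v i ∈ (q i).1) →
      (fun i => lab (v i)) ∈ P) :
    ∃ D ∈ coherentSets lab Adj P k, (∀ v, v ∈ D ↔ ∀ i, v.1 i ∈ (q i).1) ∧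
      ∀ i, (q i).1 = visited D i :=
  exists_coherent_of_family (q := fun i => (q i).1) hres hk hN (fun i => (q i).2.1)
    (fun i _ hs _ ht => labelSets_lab_eq (q i) hs ht) (fun i => congrArg Subtype.val (hper i))
    hstep hP

end LabelSets

section CyclicFamily

/-- A finite tuple continued periodically. -/
def cyclicFamily {α : Type*} {n : ℕ} (p : Fin (n + 1) → α) (i : ℤ) : α :=
  p (Fin.ofNat (n + 1) (i % ((n + 1 : ℕ) : ℤ)).toNat)

theorem cyclicFamily_add {α : Type*} {n : ℕ} (p : Fin (n + 1) → α) (i : ℤ) :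
    cyclicFamily p (i + (n + 1 : ℕ)) = cyclicFamily p i := by
  rw [cyclicFamily, Int.add_emod_right, cyclicFamily]

theorem cyclicFamily_val {α : Type*} {n : ℕ} (p : Fin (n + 1) → α) (i : Fin (n + 1)) :
    cyclicFamily p (i : ℕ) = p i := by
  rw [cyclicFamily, Int.emod_eq_of_lt (by positivity) (by exact_mod_cast i.2)]
  congr 1
  ext
  simp [Fin.ofNat, Nat.mod_eq_of_lt i.2]

theorem cyclicFamily_rel {α : Type*} {n : ℕ} {p : Fin (n + 1) → α} {R : α → α → Prop}
    (h : ∀ i : Fin n, R (p i.castSucc) (p i.succ)) (hl : R (p (Fin.last n)) (p 0)) (i : ℤ) :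
    R (cyclicFamily p i) (cyclicFamily p (i + 1)) := by
  have hN : (0 : ℤ) < ((n + 1 : ℕ) : ℤ) := by positivity
  have h0 := Int.emod_nonneg i hN.ne'
  rcases add_one_emod_of_lt hN i with ⟨h1, h2⟩ | ⟨h1, h2⟩
  · rw [cyclicFamily, cyclicFamily, h1, h2]
    convert hl using 2
    · ext
      simp [Fin.ofNat]
    · rfl
  · rw [cyclicFamily, cyclicFamily, h2]
    obtain ⟨a, ha⟩ := Int.eq_ofNat_of_zero_le h0
    rw [ha] at h1 ⊢
    have han : a < n := by push_cast at h1; omega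
    convert h ⟨a, han⟩ using 2
    · ext
      simp [Fin.ofNat, Nat.mod_eq_of_lt (Nat.lt_succ_of_lt han)]
    · ext
      have : ((a : ℤ) + 1).toNat = a + 1 := by omega
      simp [Fin.ofNat, this, Nat.mod_eq_of_lt (Nat.succ_lt_succ han)]

end CyclicFamily

/-! ### The trace formula for periodic points -/

section TraceFormula

variable {Ω : Type*} {β : Type*} [LinearOrder Ω] {lab : Ω → β} {Adj : Ω → Ω → Prop}

/-- The periodic points with period `N` in `Z`. -/
def periodicIn (Z : Set (ℤ → β)) (N : ℤ) : Set (ℤ → β) := {y | y ∈ Z ∧ ∀ i, y (i + N) = y i}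

/-- With `t i` the sign of the enumeration at time `i`, the factors `t i * t (i + 1)` telescope to
`t 0 * t (n + 1)`. Invariance of `D` under the shift turns `t (n + 1)` into `t 0` times the sign of
the shift on `D`. -/
theorem prod_matA_visited {P : Set (ℤ → β)} [DecidableEq (periodicPaths lab Adj P)]
    (hres : Resolving lab Adj) {n : ℕ} (hP : ∀ y ∈ P, ∀ i, y (i + (n + 1 : ℕ)) = y i)
    {D : Finset (periodicPaths lab Adj P)}
    (hcoh : ∀ v ∈ D, ∀ w ∈ D, pathLabel v = pathLabel w)
    (hinv : ∀ v, shiftPerm lab Adj (n + 1 : ℕ) hP v ∈ D ↔ v ∈ D) {k : ℕ} (hcard : D.card = k)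
    {p : Fin (n + 1) → LabelSets lab k} (hp : ∀ i, (p i).1 = visited D (i : ℕ)) :
    (∏ i : Fin n, matA lab Adj k (p i.castSucc) (p i.succ)) *
      matA lab Adj k (p (Fin.last n)) (p 0) = restrictSign (shiftPerm lab Adj (n + 1 : ℕ) hP) D := by
  set π := shiftPerm lab Adj (n + 1 : ℕ) hP with hπ
  let e : Fin k ≃ D := (D.equivFinOfCardEq hcard).symm
  let t : ℤ → ℤ := fun i => tupleSign fun j => (e j).1.1 i
  have ht : ∀ i, t i * t i = 1 := tupleSign_visited_mul_self hres hcoh e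
  have h1 : ∀ i : Fin n, matA lab Adj k (p i.castSucc) (p i.succ) =
      t (i : ℕ) * t ((i : ℕ) + 1) := fun i =>
    matA_visited hres hcoh e (hp i.castSucc) (by rw [hp i.succ]; simp)
  have h2 : matA lab Adj k (p (Fin.last n)) (p 0) = t n * t (n + 1) := by
    refine matA_visited hres hcoh e (hp _) ?_
    rw [hp 0]
    ext s
    simp only [mem_visited]
    constructor
    · rintro ⟨v, hv, rfl⟩
      refine ⟨π.symm v, (hinv _).1 (by simpa using hv), ?_⟩
      have := shiftPerm_apply hP (π.symm v) 0
      rw [← hπ, Equiv.apply_symm_apply] at this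
      simpa using this.symm
    · rintro ⟨v, hv, rfl⟩
      exact ⟨π v, (hinv v).2 hv, by simp [hπ, shiftPerm_apply]⟩
  have h3 : t (n + 1) = restrictSign π D * t 0 := by
    rw [← tupleSign_apply_perm hinv e fun v => v.1 0]
    simp [t, hπ, shiftPerm_apply]
  rw [Finset.prod_congr rfl fun i _ => h1 i, prod_mul_succ_eq ht, h2, h3]
  linear_combination (restrictSign π D * t 0 ^ 2) * ht n + restrictSign π D * ht 0

/-- The tuple is repeated with period `n + 1`. The set of all paths inside this periodic family is
invariant under the shift. -/
theorem exists_coherent_of_cyclic {Z : Set (ℤ → β)} {n : ℕ}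
    [Fintype (periodicPaths lab Adj (periodicIn Z (n + 1 : ℕ)))]
    (hres : Resolving lab Adj)
    (hZ : ∀ v : ℤ → Ω, (∀ i, Adj (v i) (v (i + 1))) → (fun i => lab (v i)) ∈ Z)
    (hP : ∀ y ∈ periodicIn Z (n + 1 : ℕ), ∀ i, y (i + (n + 1 : ℕ)) = y i)
    {k : ℕ} (hk : k ≠ 0) {p : Fin (n + 1) → LabelSets lab k}
    (hp : ∀ i : Fin n, (stepMaps Adj (p i.castSucc).1 (p i.succ).1).Nonempty)
    (hlast : (stepMaps Adj (p (Fin.last n)).1 (p 0).1).Nonempty) :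
    ∃ D ∈ coherentSets lab Adj (periodicIn Z (n + 1 : ℕ)) k,
      (∀ v, shiftPerm lab Adj (n + 1 : ℕ) hP v ∈ D ↔ v ∈ D) ∧
      ∀ i, (p i).1 = visited D (i : ℕ) := by
  have hstep : ∀ i, (stepMaps Adj (cyclicFamily p i).1 (cyclicFamily p (i + 1)).1).Nonempty :=
    cyclicFamily_rel (R := fun a b : LabelSets lab k => (stepMaps Adj a.1 b.1).Nonempty) hp hlast
  obtain ⟨D, hD, hmem, hvis⟩ := exists_coherent_of_labelSets (P := periodicIn Z (n + 1 : ℕ)) hres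
    hk n.succ_pos (cyclicFamily p) (cyclicFamily_add p) hstep fun v hv hvq => ⟨hZ v hv, fun i => by
      refine labelSets_lab_eq (cyclicFamily p i) ?_ (hvq i)
      rw [← cyclicFamily_add]
      exact hvq _⟩
  refine ⟨D, hD, fun v => ?_, fun i => ?_⟩
  · rw [hmem, hmem]
    constructor
    · intro h i
      have := h (i - (n + 1 : ℕ))
      rwa [← cyclicFamily_add, shiftPerm_apply, sub_add_cancel] at this
    · intro h i
      have := h (i + (n + 1 : ℕ))
      rwa [cyclicFamily_add] at this
  · rw [← hvis, cyclicFamily_val]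

theorem trace_formula [Fintype Ω] (hres : Resolving lab Adj) {Z : Set (ℤ → β)}
    (hZ : ∀ v : ℤ → Ω, (∀ i, Adj (v i) (v (i + 1))) → (fun i => lab (v i)) ∈ Z) (n : ℕ)
    (hlift : ∀ y ∈ periodicIn Z (n + 1 : ℕ), ∃ z : ℤ → Ω, (∀ i, Adj (z i) (z (i + 1))) ∧
      (∀ i, z (i + (n + 1 : ℕ)) = z i) ∧ ∀ i, lab (z i) = y i) :
    ∑ k ∈ Finset.Icc 1 (Fintype.card Ω), (-1) ^ (k + 1) * (matA lab Adj k ^ (n + 1)).trace =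
      ((periodicIn Z (n + 1 : ℕ)).ncard : ℤ) := by
  classical
  have hper : ∀ y ∈ periodicIn Z (n + 1 : ℕ), ∀ i, y (i + (n + 1 : ℕ)) = y i := fun y hy => hy.2
  have := finite_periodicPaths hres n.succ_pos hper
  have := Fintype.ofFinite (periodicPaths lab Adj (periodicIn Z (n + 1 : ℕ)))
  -- Only one symmetry matters here; the second permutation is the identity.
  rw [← signed_sum_coherentSets hres (shiftPerm lab Adj (n + 1 : ℕ) hper) 1]
  · refine Finset.sum_congr rfl fun k hk => ?_
    have hk : k ≠ 0 := by have := (Finset.mem_Icc.1 hk).1; omega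
    congr 1
    rw [trace_pow_succ_eq_sum_tuple]
    refine sum_tuples_eq_sum_coherentSets hres hk ?_ _ _ ?_ ?_
    · intro y hy y' hy' h
      funext i
      rw [← apply_emod_of_periodic (hper y hy), ← apply_emod_of_periodic (hper y' hy')]
      have hN : (0 : ℤ) < ((n + 1 : ℕ) : ℤ) := by positivity
      have h0 := Int.emod_nonneg i hN.ne'
      have h1 := Int.emod_lt_of_pos i hN
      obtain ⟨a, ha⟩ := Int.eq_ofNat_of_zero_le h0
      rw [ha] at h1 ⊢
      exact h a (by omega)
    · intro D hD hne p hp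
      obtain ⟨hcard, hcoh⟩ := (mem_coherentSets hk).1 hD
      rw [restrictSign_one, mul_one] at hne ⊢
      exact prod_matA_visited hres hper hcoh (invariant_of_restrictSign_ne_zero hne) hcard hp
    · intro p hp
      obtain ⟨D, hD, hinv, hvis⟩ := exists_coherent_of_cyclic hres hZ hper hk
        (fun i => stepMaps_nonempty_of_matA_ne_zero
          (Finset.prod_ne_zero_iff.1 (left_ne_zero_of_mul hp) i (Finset.mem_univ _)))
        (stepMaps_nonempty_of_matA_ne_zero (right_ne_zero_of_mul hp))
      refine ⟨D, hD, ?_, hvis⟩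
      rw [restrictSign_one, mul_one]
      exact restrictSign_ne_zero hinv
  · intro y hy
    obtain ⟨z, h1, h2, h3⟩ := hlift y hy
    have hlab : (fun i => lab (z i)) = y := funext h3
    refine ⟨⟨z, h1, ⟨(n + 1 : ℕ), by positivity, h2⟩, by rwa [hlab]⟩, hlab, ?_, rfl⟩
    exact Subtype.ext (funext h2)

end TraceFormula

/-! ### Reflected families -/

/-- The segment `r 0, …, r n` is unfolded by the reflection in `d` and then repeated with period `d
- c`. An even `c` or `d` puts the mirror on a vertex, which must be fixed by `st`; an odd one puts
it on an edge, which must join a vertex to its image. -/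
theorem exists_reflected_family {α : Type*} {st : α → α} (hst : ∀ a, st (st a) = a)
    {R : α → α → Prop} (hR : ∀ a b, R a b → R (st b) (st a)) {n : ℕ} (r : ℤ → α) {c d : ℤ}
    (hcd : c < d) (hn : d = 2 * n → 0 < n) (hr : ∀ i : ℤ, 0 ≤ i → i < n → R (r i) (r (i + 1)))
    (hc : c = 0 ∧ st (r 0) = r 0 ∨ c = -1 ∧ R (st (r 0)) (r 0))
    (hd : d = 2 * n ∧ st (r n) = r n ∨ d = 2 * n + 1 ∧ R (r n) (st (r n))) :
    ∃ q : ℤ → α, (∀ i : ℤ, 0 ≤ i → i ≤ n → q i = r i) ∧ (∀ i, R (q i) (q (i + 1))) ∧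
      (∀ i, q (c - i) = st (q i)) ∧ ∀ i, q (d - i) = st (q i) := by
  obtain ⟨N, hN⟩ : ∃ N, N = d - c := ⟨_, rfl⟩
  have hN0 : 0 < N := by omega
  have hnN : (n : ℤ) < N := by omega
  -- The edge from `N - 1` to `N`, where one period closes up.
  have hcR : n < N - 1 → R (st (r (c + 1))) (r 0) := by
    intro hlt
    rcases hc with ⟨h, h'⟩ | ⟨h, h'⟩
    · have hn : (0 : ℤ) < n := by omega
      have := hR _ _ (hr 0 le_rfl hn)
      rwa [h', ← congrArg (· + 1) h] at this
    · rwa [h, neg_add_cancel]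
  -- The edge from `n` to `n + 1`, where the reflected half begins. For `d = 2 * n` the hypothesis
  -- `hn` keeps the index `n - 1` inside the given segment.
  have hdR : R (r n) (st (r (d - n - 1))) := by
    rcases hd with ⟨h, h'⟩ | ⟨h, h'⟩
    · have h1 : (0 : ℤ) ≤ n - 1 := by have := hn h; omega
      have := hR _ _ (hr (n - 1) h1 (by omega))
      rw [sub_add_cancel, h'] at this
      convert this using 3
      omega
    · convert h' using 3
      omega
  obtain ⟨q, hq⟩ : ∃ q : ℤ → α,
      ∀ i, q i = if i % N ≤ n then r (i % N) else st (r (d - i % N)) := ⟨_, fun _ => rfl⟩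
  have hper : ∀ i, q (i + N) = q i := fun i => by rw [hq, hq, Int.add_emod_right]
  have hqc : ∀ i, q (c - i) = st (q i) := by
    intro i
    have h0 := Int.emod_nonneg i hN0.ne'
    have h1 := Int.emod_lt_of_pos i hN0
    have h2 : (c - i) % N = (c - i % N) % N := by rw [Int.sub_emod_emod]
    rw [hq, hq, h2]
    -- This is the only case where `c - i % N` is already a residue; otherwise `N` has to be added,
    -- which gives `d - i % N`.
    by_cases hi : c = 0 ∧ i % N = 0
    · rw [hi.1, hi.2]
      rcases hc with ⟨_, h⟩ | ⟨h, _⟩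
      · simp [h]
      · omega
    · have h3 : (c - i % N) % N = d - i % N := by
        rw [← Int.add_emod_right, Int.emod_eq_of_lt (by omega) (by omega)]
        omega
      rw [h3]
      by_cases h4 : i % N ≤ n
      · rw [if_pos h4]
        by_cases h5 : d - i % N ≤ n
        · rw [if_pos h5]
          rcases hd with ⟨h, h'⟩ | ⟨h, h'⟩
          · have h6 : i % N = n := by omega
            have h7 : d - i % N = n := by omega
            rw [h7, h6, h']
          · omega
        · rw [if_neg h5, sub_sub_cancel]
      · rw [if_neg h4, if_pos (by omega), hst]
  refine ⟨q, fun i h0 h1 => ?_, fun i => ?_, hqc, fun i => ?_⟩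
  · rw [hq, Int.emod_eq_of_lt h0 (by omega), if_pos h1]
  · have h0 := Int.emod_nonneg i hN0.ne'
    rw [hq i, hq (i + 1)]
    rcases add_one_emod_of_lt hN0 i with ⟨h1, h2⟩ | ⟨h1, h2⟩
    · rw [h2, h1, if_pos (show (0 : ℤ) ≤ n by omega)]
      by_cases h3 : N - 1 ≤ n
      · rw [if_pos h3]
        have h4 : N - 1 = n := by omega
        rw [h4]
        have h5 : d - n - 1 = c := by omega
        rw [h5] at hdR
        rcases hc with ⟨h, h'⟩ | ⟨h, h'⟩
        · rwa [h, h'] at hdR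
        · omega
      · rw [if_neg h3]
        convert hcR (by omega) using 3
        omega
    · rw [h2]
      rcases lt_trichotomy (i % N) n with h | h | h
      · rw [if_pos h.le, if_pos (by omega)]
        exact hr _ h0 h
      · rw [if_pos h.le, if_neg (by omega), h]
        convert hdR using 3
        omega
      · rw [if_neg (by omega), if_neg (by omega)]
        have := hR _ _ (hr (d - i % N - 1) (by omega) (by omega))
        convert this using 3
        · omega
        · omega
  · have : d - i = c - i + N := by omega
    rw [this, hper, hqc]

/-! ### The formula for points fixed by two reflections -/

section FlipFormula

variable {Ω : Type*} {β : Type*} [LinearOrder Ω] {lab : Ω → β} {Adj : Ω → Ω → Prop}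

/-- An injection between sets of equal size is invertible; conjugating its inverse by `star`
reverses the transitions. -/
theorem stepMaps_image_star_nonempty {star : Ω → Ω} (hstar : ∀ s, star (star s) = s)
    (hadj : ∀ s t, Adj s t → Adj (star t) (star s)) {S T : Finset Ω} (hST : S.card = T.card)
    (h : (stepMaps Adj S T).Nonempty) :
    (stepMaps Adj (T.image star) (S.image star)).Nonempty := by
  obtain ⟨f, hf⟩ := h
  simp only [stepMaps, Finset.mem_filter, Finset.mem_univ, true_and] at hf
  have hbij : Function.Bijective f :=
    (Fintype.bijective_iff_injective_and_card f).2 ⟨f.injective, by simpa using hST⟩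
  let e : S ≃ T := Equiv.ofBijective f hbij
  have hmem : ∀ {U : Finset Ω} (x : U.image star), star x ∈ U := fun {U} x => by
    obtain ⟨s, hs, h⟩ := Finset.mem_image.1 x.2
    rw [← h, hstar]
    exact hs
  refine ⟨⟨fun x => ⟨star (e.symm ⟨star x, hmem x⟩), Finset.mem_image_of_mem _ (e.symm _).2⟩,
    fun x y hxy => ?_⟩, ?_⟩
  · have h1 := Function.LeftInverse.injective hstar (congrArg Subtype.val hxy)
    have h2 := congrArg Subtype.val (e.symm.injective (Subtype.ext h1))
    exact Subtype.ext (Function.LeftInverse.injective hstar h2)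
  · simp only [stepMaps, Finset.mem_filter, Finset.mem_univ, true_and]
    intro x
    have h1 := hadj _ _ (hf (e.symm ⟨star x, hmem x⟩))
    have h2 : f (e.symm ⟨star x, hmem x⟩) = ⟨star x, hmem x⟩ := e.apply_symm_apply _
    rw [h2, hstar] at h1
    exact h1

/-- The points of `Z` that are fixed by the reflections `y ↦ (τ y_{c-i})_i` and
`y ↦ (τ y_{d-i})_i`. -/
def reflectedIn (τ : β → β) (Z : Set (ℤ → β)) (c d : ℤ) : Set (ℤ → β) :=
  {y | y ∈ Z ∧ (∀ i, y (c - i) = τ (y i)) ∧ ∀ i, y (d - i) = τ (y i)}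

theorem apply_add_of_mem_reflectedIn {τ : β → β} (hτ : ∀ b, τ (τ b) = b) {Z : Set (ℤ → β)}
    {c d : ℤ} {y : ℤ → β} (hy : y ∈ reflectedIn τ Z c d) (i : ℤ) : y (i + (d - c)) = y i := by
  have h1 := hy.2.2 (c - i)
  rw [hy.2.1, hτ] at h1
  rw [← h1]
  congr 1
  ring

/-- The interval `[0, n]` meets every orbit of the dihedral action: a residue mod `d - c` beyond `n`
is reflected into it by `i ↦ d - i`. -/
theorem eq_of_mem_reflectedIn {τ : β → β} (hτ : ∀ b, τ (τ b) = b) {Z : Set (ℤ → β)}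
    {c d : ℤ} (hcd : c < d) {n : ℕ} (hc : -1 ≤ c) (hd : d ≤ 2 * n + 1) {y y' : ℤ → β}
    (hy : y ∈ reflectedIn τ Z c d) (hy' : y' ∈ reflectedIn τ Z c d)
    (h : ∀ i : ℕ, i ≤ n → y i = y' i) : y = y' := by
  have h' : ∀ i : ℤ, 0 ≤ i → i ≤ n → y i = y' i := fun i h0 h1 => by
    lift i to ℕ using h0
    exact h i (by exact_mod_cast h1)
  funext i
  rw [← apply_emod_of_periodic (apply_add_of_mem_reflectedIn hτ hy),
    ← apply_emod_of_periodic (apply_add_of_mem_reflectedIn hτ hy')]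
  have hN : 0 < d - c := by omega
  have h0 := Int.emod_nonneg i hN.ne'
  have h1 := Int.emod_lt_of_pos i hN
  by_cases h2 : i % (d - c) ≤ n
  · exact h' _ h0 h2
  · have e1 := hy.2.2 (d - i % (d - c))
    have e2 := hy'.2.2 (d - i % (d - c))
    rw [sub_sub_cancel] at e1 e2
    rw [e1, e2, h' _ (by omega) (by omega)]

variable {star : Ω → Ω} {τ : β → β}

theorem starSet_starSet (hstar : ∀ s, star (star s) = s) (hlab : ∀ s, lab (star s) = τ (lab s))
    {k : ℕ} (p : LabelSets lab k) : starSet hstar hlab (starSet hstar hlab p) = p :=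
  Subtype.ext <| by
    simp [starSet, Finset.image_image, Function.comp_def, hstar]

theorem starSet_eq_of_matJ_ne_zero (hstar : ∀ s, star (star s) = s)
    (hlab : ∀ s, lab (star s) = τ (lab s)) {k : ℕ} {p q : LabelSets lab k}
    (h : matJ lab star k p q ≠ 0) : starSet hstar hlab p = q := by
  by_contra he
  rw [matJ, Matrix.of_apply, if_neg fun h' : p.1.image star = q.1 => he (Subtype.ext h')] at h
  exact h rfl

theorem matJ_visited_self {P : Set (ℤ → β)} [DecidableEq (periodicPaths lab Adj P)]
    (hstar : ∀ s, star (star s) = s) (hlab : ∀ s, lab (star s) = τ (lab s))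
    (hadj : ∀ s t, Adj s t → Adj (star t) (star s)) {c : ℤ}
    (hP : ∀ y ∈ P, ∀ i, y (c - i) = τ (y i)) (hres : Resolving lab Adj)
    {D : Finset (periodicPaths lab Adj P)} (hcoh : ∀ v ∈ D, ∀ w ∈ D, pathLabel v = pathLabel w)
    (hinv : ∀ x, reflectPerm lab Adj hstar hlab hadj c hP x ∈ D ↔ x ∈ D) {k : ℕ} (e : Fin k ≃ D)
    {i : ℤ} (hi : i + i = c) {p : LabelSets lab k} (hp : p.1 = visited D i) :
    matJ lab star k p p = restrictSign (reflectPerm lab Adj hstar hlab hadj c hP) D := by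
  rw [matJ_visited hstar hlab hadj hP hres hcoh hinv e hi hp hp, ← mul_assoc,
    tupleSign_visited_mul_self hres hcoh e, one_mul]

theorem starSet_visited {P : Set (ℤ → β)}
    (hstar : ∀ s, star (star s) = s) (hlab : ∀ s, lab (star s) = τ (lab s))
    (hadj : ∀ s t, Adj s t → Adj (star t) (star s)) {c : ℤ}
    (hP : ∀ y ∈ P, ∀ i, y (c - i) = τ (y i))
    {D : Finset (periodicPaths lab Adj P)}
    (hinv : ∀ x, reflectPerm lab Adj hstar hlab hadj c hP x ∈ D ↔ x ∈ D) {k : ℕ}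
    {i i' : ℤ} (hi : i + i' = c) {p : LabelSets lab k}
    (hp : p.1 = visited D i) : (starSet hstar hlab p).1 = visited D i' := by
  rw [← image_star_visited hstar hlab hadj hP hinv hi, ← hp]
  rfl

/-- `J` leads from time `i` to `i - 1` and `A` back to `i`. Each enumeration sign occurs twice, so
only the sign of the reflection remains. -/
theorem matJ_mul_matA_visited [Fintype Ω] {P : Set (ℤ → β)} [DecidableEq (periodicPaths lab Adj P)]
    (hstar : ∀ s, star (star s) = s) (hlab : ∀ s, lab (star s) = τ (lab s))
    (hadj : ∀ s t, Adj s t → Adj (star t) (star s)) {c : ℤ}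
    (hP : ∀ y ∈ P, ∀ i, y (c - i) = τ (y i)) (hres : Resolving lab Adj)
    {D : Finset (periodicPaths lab Adj P)} (hcoh : ∀ v ∈ D, ∀ w ∈ D, pathLabel v = pathLabel w)
    (hinv : ∀ x, reflectPerm lab Adj hstar hlab hadj c hP x ∈ D ↔ x ∈ D) {k : ℕ} (e : Fin k ≃ D)
    {i : ℤ} (hi : i + (i - 1) = c) {p : LabelSets lab k}
    (hp : p.1 = visited D i) : (matJ lab star k * matA lab Adj k) p p =
      restrictSign (reflectPerm lab Adj hstar hlab hadj c hP) D := by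
  have hs := starSet_visited hstar hlab hadj hP hinv hi hp
  rw [matJ_mul_matA_apply hstar hlab, matJ_visited hstar hlab hadj hP hres hcoh hinv e hi hp hs,
    matA_visited hres hcoh e hs (by rwa [sub_add_cancel]), sub_add_cancel]
  have h1 := tupleSign_visited_mul_self hres hcoh e i
  have h2 := tupleSign_visited_mul_self hres hcoh e (i - 1)
  linear_combination (restrictSign (reflectPerm lab Adj hstar hlab hadj c hP) D *
    (tupleSign (fun j => (e j).1.1 (i - 1)) * tupleSign fun j => (e j).1.1 (i - 1))) * h1 +
    restrictSign (reflectPerm lab Adj hstar hlab hadj c hP) D * h2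

theorem matA_mul_matJ_visited [Fintype Ω] {P : Set (ℤ → β)} [DecidableEq (periodicPaths lab Adj P)]
    (hstar : ∀ s, star (star s) = s) (hlab : ∀ s, lab (star s) = τ (lab s))
    (hadj : ∀ s t, Adj s t → Adj (star t) (star s)) {c : ℤ}
    (hP : ∀ y ∈ P, ∀ i, y (c - i) = τ (y i)) (hres : Resolving lab Adj)
    {D : Finset (periodicPaths lab Adj P)} (hcoh : ∀ v ∈ D, ∀ w ∈ D, pathLabel v = pathLabel w)
    (hinv : ∀ x, reflectPerm lab Adj hstar hlab hadj c hP x ∈ D ↔ x ∈ D) {k : ℕ} (e : Fin k ≃ D)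
    {i : ℤ} (hi : i + 1 + i = c) {p : LabelSets lab k}
    (hp : p.1 = visited D i) : (matA lab Adj k * matJ lab star k) p p =
      restrictSign (reflectPerm lab Adj hstar hlab hadj c hP) D := by
  have hs := starSet_visited hstar hlab hadj hP hinv (i' := i + 1) (by omega) hp
  rw [matA_mul_matJ_apply hstar hlab, matJ_visited hstar hlab hadj hP hres hcoh hinv e hi hs hp,
    matA_visited hres hcoh e hp hs]
  have h1 := tupleSign_visited_mul_self hres hcoh e i
  have h2 := tupleSign_visited_mul_self hres hcoh e (i + 1)
  linear_combination (restrictSign (reflectPerm lab Adj hstar hlab hadj c hP) D *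
    (tupleSign (fun j => (e j).1.1 (i + 1)) * tupleSign fun j => (e j).1.1 (i + 1))) * h1 +
    restrictSign (reflectPerm lab Adj hstar hlab hadj c hP) D * h2

/-- The set of all paths inside the unfolded family inherits both reflection symmetries, and so do
their labels. -/
theorem exists_coherent_of_reflected (hstar : ∀ s, star (star s) = s)
    (hlab : ∀ s, lab (star s) = τ (lab s)) (hadj : ∀ s t, Adj s t → Adj (star t) (star s))
    {Z : Set (ℤ → β)} {c d : ℤ} (hcd : c < d)
    [Fintype (periodicPaths lab Adj (reflectedIn τ Z c d))] (hres : Resolving lab Adj)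
    (hZ : ∀ v : ℤ → Ω, (∀ i, Adj (v i) (v (i + 1))) → (fun i => lab (v i)) ∈ Z)
    (hPc : ∀ y ∈ reflectedIn τ Z c d, ∀ i, y (c - i) = τ (y i))
    (hPd : ∀ y ∈ reflectedIn τ Z c d, ∀ i, y (d - i) = τ (y i))
    {k : ℕ} (hk : k ≠ 0) {n : ℕ} (hn0 : d = 2 * n → 0 < n) {p : Fin (n + 1) → LabelSets lab k}
    (hp : ∀ i : Fin n, (stepMaps Adj (p i.castSucc).1 (p i.succ).1).Nonempty)
    (hc : c = 0 ∧ starSet hstar hlab (p 0) = p 0 ∨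
      c = -1 ∧ (stepMaps Adj (starSet hstar hlab (p 0)).1 (p 0).1).Nonempty)
    (hd : d = 2 * n ∧ starSet hstar hlab (p (Fin.last n)) = p (Fin.last n) ∨ d = 2 * n + 1 ∧
      (stepMaps Adj (p (Fin.last n)).1 (starSet hstar hlab (p (Fin.last n))).1).Nonempty) :
    ∃ D ∈ coherentSets lab Adj (reflectedIn τ Z c d) k,
      (∀ v, reflectPerm lab Adj hstar hlab hadj c hPc v ∈ D ↔ v ∈ D) ∧
      (∀ v, reflectPerm lab Adj hstar hlab hadj d hPd v ∈ D ↔ v ∈ D) ∧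
      ∀ i, (p i).1 = visited D (i : ℕ) := by
  have hfin : ∀ i : ℕ, ∀ hi : i < n + 1, cyclicFamily p i = p ⟨i, hi⟩ := fun i hi =>
    cyclicFamily_val p ⟨i, hi⟩
  have h0 : cyclicFamily p 0 = p 0 := cyclicFamily_val p 0
  have hn : cyclicFamily p n = p (Fin.last n) := cyclicFamily_val p (Fin.last n)
  obtain ⟨q, hq, hstep, hqc, hqd⟩ := exists_reflected_family (starSet_starSet hstar hlab)
    (R := fun a b : LabelSets lab k => (stepMaps Adj a.1 b.1).Nonempty)
    (fun a b h => stepMaps_image_star_nonempty hstar hadj (a.2.1.trans b.2.1.symm) h)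
    (n := n) (cyclicFamily p) hcd hn0
    (fun i hi0 hi => by
      lift i to ℕ using hi0
      have hi : i < n := by exact_mod_cast hi
      have := hp ⟨i, hi⟩
      rw [hfin i (by omega), show ((i : ℤ) + 1) = ((i + 1 : ℕ) : ℤ) by push_cast; rfl,
        hfin (i + 1) (by omega)]
      exact this)
    (by rwa [h0]) (by rwa [hn])
  have hper : ∀ i, q (i + (d - c).toNat) = q i := fun i => by
    have h1 := hqd (c - i)
    rw [hqc, starSet_starSet] at h1
    rw [← h1]
    congr 1
    omega
  have hrefl : ∀ (b : ℤ), (∀ i, q (b - i) = starSet hstar hlab (q i)) → ∀ v : ℤ → Ω,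
      (∀ i, v i ∈ (q i).1) → ∀ i, star (v (b - i)) ∈ (q i).1 := by
    intro b hb v hv i
    have h1 := hb (b - i)
    rw [sub_sub_cancel] at h1
    rw [h1]
    exact Finset.mem_image_of_mem _ (hv _)
  have hlabel : ∀ (b : ℤ), (∀ i, q (b - i) = starSet hstar hlab (q i)) → ∀ v : ℤ → Ω,
      (∀ i, v i ∈ (q i).1) → ∀ i, lab (v (b - i)) = τ (lab (v i)) := by
    intro b hb v hv i
    have h1 := labelSets_lab_eq (q (b - i)) (hv _) (hrefl b hb v hv (b - i))
    rw [sub_sub_cancel, hlab] at h1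
    exact h1
  obtain ⟨D, hD, hmem, hvis⟩ := exists_coherent_of_labelSets (P := reflectedIn τ Z c d) hres
    hk (N := (d - c).toNat) (by omega) q hper hstep fun v hv hvq =>
      ⟨hZ v hv, hlabel c hqc v hvq, hlabel d hqd v hvq⟩
  have hinv : ∀ (b : ℤ) (hP : ∀ y ∈ reflectedIn τ Z c d, ∀ i, y (b - i) = τ (y i)),
      (∀ i, q (b - i) = starSet hstar hlab (q i)) →
      ∀ v, reflectPerm lab Adj hstar hlab hadj b hP v ∈ D ↔ v ∈ D := by
    intro b hP hb v
    have h1 : ∀ v, v ∈ D → reflectPerm lab Adj hstar hlab hadj b hP v ∈ D := fun v hv =>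
      (hmem _).2 (hrefl b hb v.1 ((hmem v).1 hv))
    refine ⟨fun h => ?_, h1 v⟩
    have h2 := h1 _ h
    have h3 : reflectPerm lab Adj hstar hlab hadj b hP
        (reflectPerm lab Adj hstar hlab hadj b hP v) = v :=
      Subtype.ext <| funext fun i => by simp [reflectPerm_apply, hstar]
    rwa [h3] at h2
  refine ⟨D, hD, hinv c hPc hqc, hinv d hPd hqd, fun i => ?_⟩
  rw [← hvis, hq _ (by positivity) (by exact_mod_cast Fin.is_le i), cyclicFamily_val]

theorem flip_formula [Fintype Ω] (hstar : ∀ s, star (star s) = s)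
    (hlab : ∀ s, lab (star s) = τ (lab s)) (hadj : ∀ s t, Adj s t → Adj (star t) (star s))
    (hτ : ∀ b, τ (τ b) = b) (hres : Resolving lab Adj) {Z : Set (ℤ → β)}
    (hZ : ∀ v : ℤ → Ω, (∀ i, Adj (v i) (v (i + 1))) → (fun i => lab (v i)) ∈ Z)
    {c d : ℤ} (hcd : c < d) (n : ℕ) (hn : d = 2 * n → 0 < n)
    (hlift : ∀ y ∈ reflectedIn τ Z c d, ∃ z : ℤ → Ω, (∀ i, Adj (z i) (z (i + 1))) ∧
      (∀ i, star (z (c - i)) = z i) ∧ (∀ i, star (z (d - i)) = z i) ∧ ∀ i, lab (z i) = y i)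
    (L R : ∀ k, Matrix (LabelSets lab k) (LabelSets lab k) ℤ)
    (hL : c = 0 ∧ (∀ k, L k = matJ lab star k) ∨
      c = -1 ∧ ∀ k, L k = matJ lab star k * matA lab Adj k)
    (hR : d = 2 * n ∧ (∀ k, R k = matJ lab star k) ∨
      d = 2 * n + 1 ∧ ∀ k, R k = matA lab Adj k * matJ lab star k) :
    ∑ k ∈ Finset.Icc 1 (Fintype.card Ω), (-1) ^ (k + 1) *
      entrySum (diagPart (L k) * matB lab Adj k ^ n * diagPart (R k)) =
      ((reflectedIn τ Z c d).ncard : ℤ) := by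
  classical
  have hPc : ∀ y ∈ reflectedIn τ Z c d, ∀ i, y (c - i) = τ (y i) := fun y hy => hy.2.1
  have hPd : ∀ y ∈ reflectedIn τ Z c d, ∀ i, y (d - i) = τ (y i) := fun y hy => hy.2.2
  have := finite_periodicPaths (P := reflectedIn τ Z c d) hres (N := (d - c).toNat) (by omega)
    fun y hy i => by
      rw [Int.toNat_of_nonneg (by omega)]
      exact apply_add_of_mem_reflectedIn hτ hy i
  have := Fintype.ofFinite (periodicPaths lab Adj (reflectedIn τ Z c d))
  rw [← signed_sum_coherentSets hres (reflectPerm lab Adj hstar hlab hadj c hPc)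
    (reflectPerm lab Adj hstar hlab hadj d hPd)]
  · refine Finset.sum_congr rfl fun k hk => ?_
    have hk : k ≠ 0 := by have := (Finset.mem_Icc.1 hk).1; omega
    congr 1
    rw [entrySum_diag_mul_pow_mul_diag]
    refine sum_tuples_eq_sum_coherentSets hres hk ?_ _ _ ?_ ?_
    · exact fun y hy y' hy' h => eq_of_mem_reflectedIn hτ hcd (by omega) (by omega) hy hy' h
    · intro D hD hne p hp
      obtain ⟨hcard, hcoh⟩ := (mem_coherentSets hk).1 hD
      have hc := invariant_of_restrictSign_ne_zero (left_ne_zero_of_mul hne)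
      have hd := invariant_of_restrictSign_ne_zero (right_ne_zero_of_mul hne)
      let e : Fin k ≃ D := (D.equivFinOfCardEq hcard).symm
      have hB : ∏ i : Fin n, matB lab Adj k (p i.castSucc) (p i.succ) = 1 :=
        Finset.prod_eq_one fun i _ =>
          matB_visited hres hcoh (hp i.castSucc) (by rw [hp i.succ]; simp)
      -- The parity of `c` decides whether the mirror lies on the vertex at time `0` or on the edge
      -- from `-1` to `0`.
      have h1 : L k (p 0) (p 0) = restrictSign (reflectPerm lab Adj hstar hlab hadj c hPc) D := by
        rcases hL with ⟨rfl, hL⟩ | ⟨rfl, hL⟩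
        · rw [hL]
          exact matJ_visited_self hstar hlab hadj hPc hres hcoh hc e (i := 0) (by simp) (hp 0)
        · rw [hL]
          exact matJ_mul_matA_visited hstar hlab hadj hPc hres hcoh hc e (i := 0) (by simp) (hp 0)
      have h2 : R k (p (Fin.last n)) (p (Fin.last n)) =
          restrictSign (reflectPerm lab Adj hstar hlab hadj d hPd) D := by
        rcases hR with ⟨hdn, hR⟩ | ⟨hdn, hR⟩
        · rw [hR]
          exact matJ_visited_self hstar hlab hadj hPd hres hcoh hd e (i := n) (by omega) (hp _)
        · rw [hR]
          exact matA_mul_matJ_visited hstar hlab hadj hPd hres hcoh hd e (i := n) (by omega) (hp _)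
      rw [hB, h1, h2, one_mul]
    · intro p hp
      have hc : c = 0 ∧ starSet hstar hlab (p 0) = p 0 ∨
          c = -1 ∧ (stepMaps Adj (starSet hstar hlab (p 0)).1 (p 0).1).Nonempty := by
        have hne := left_ne_zero_of_mul (right_ne_zero_of_mul hp)
        rcases hL with ⟨h, hL⟩ | ⟨h, hL⟩
        · rw [hL] at hne
          exact Or.inl ⟨h, starSet_eq_of_matJ_ne_zero hstar hlab hne⟩
        · rw [hL, matJ_mul_matA_apply hstar hlab] at hne
          exact Or.inr ⟨h, stepMaps_nonempty_of_matA_ne_zero (right_ne_zero_of_mul hne)⟩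
      have hd : d = 2 * n ∧ starSet hstar hlab (p (Fin.last n)) = p (Fin.last n) ∨
          d = 2 * n + 1 ∧
            (stepMaps Adj (p (Fin.last n)).1 (starSet hstar hlab (p (Fin.last n))).1).Nonempty := by
        have hne := right_ne_zero_of_mul (right_ne_zero_of_mul hp)
        rcases hR with ⟨h, hR⟩ | ⟨h, hR⟩
        · rw [hR] at hne
          exact Or.inl ⟨h, starSet_eq_of_matJ_ne_zero hstar hlab hne⟩
        · rw [hR, matA_mul_matJ_apply hstar hlab] at hne
          exact Or.inr ⟨h, stepMaps_nonempty_of_matA_ne_zero (left_ne_zero_of_mul hne)⟩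
      obtain ⟨D, hD, hic, hid, hvis⟩ := exists_coherent_of_reflected hstar hlab hadj hcd hres hZ
        hPc hPd hk hn (fun i => stepMaps_nonempty_of_matB_ne_zero
          (Finset.prod_ne_zero_iff.1 (left_ne_zero_of_mul hp) i (Finset.mem_univ _))) hc hd
      exact ⟨D, hD, mul_ne_zero (restrictSign_ne_zero hic) (restrictSign_ne_zero hid), hvis⟩
  · intro y hy
    obtain ⟨z, h1, h2, h3, h4⟩ := hlift y hy
    have hl : (fun i => lab (z i)) = y := funext h4
    refine ⟨⟨z, h1, ⟨d - c, by omega, fun i => ?_⟩, by rwa [hl]⟩, hl, ?_, ?_⟩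
    · rw [← h2 i, ← h3 (c - i), hstar]
      congr 1
      ring
    · exact Subtype.ext (funext h2)
    · exact Subtype.ext (funext h3)

end FlipFormula

/-! ## The joint state chain -/

/-- Any coordinate can be moved beyond `i₀` by a multiple of the common period `p * p'`. -/
theorem eq_of_periodic_of_eventually_eq {γ : Type*} {f g : ℤ → γ} {p p' : ℤ} (hp : 0 < p)
    (hp' : 0 < p') (hf : ∀ i, f (i + p) = f i) (hg : ∀ i, g (i + p') = g i) {i₀ : ℤ}
    (h : ∀ i, i₀ ≤ i → f i = g i) : f = g := by
  funext j
  have hf' : Function.Periodic f p := hf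
  have hg' : Function.Periodic g p' := hg
  have h1 := hf'.int_mul ((i₀ - j).natAbs * p') j
  have h2 := hg'.int_mul ((i₀ - j).natAbs * p) j
  rw [← h1, ← h2]
  have e : ((((i₀ - j).natAbs * p' : ℤ) : ℤ) * p) = (((i₀ - j).natAbs * p : ℤ) : ℤ) * p' := by ring
  simp only [Int.cast_id] at *
  rw [e]
  refine h _ ?_
  have h3 : i₀ - j ≤ (i₀ - j).natAbs := Int.le_natAbs
  have h4 : ((i₀ - j).natAbs : ℤ) ≤ (i₀ - j).natAbs * p * p' := by
    rw [mul_assoc]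
    exact le_mul_of_one_le_right (by positivity) (Int.add_one_le_iff.2 (mul_pos hp hp'))
  linarith

theorem eq_of_periodic_of_eventually_eq_left {γ : Type*} {f g : ℤ → γ} {p p' : ℤ} (hp : 0 < p)
    (hp' : 0 < p') (hf : ∀ i, f (i + p) = f i) (hg : ∀ i, g (i + p') = g i) {i₀ : ℤ}
    (h : ∀ i, i ≤ i₀ → f i = g i) : f = g := by
  have key : (fun i => f (-i)) = fun i => g (-i) := by
    refine eq_of_periodic_of_eventually_eq hp hp' (fun i => ?_) (fun i => ?_) (i₀ := -i₀)
      fun i hi => h _ (by omega)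
    · rw [← hf (-(i + p))]; congr 1; ring
    · rw [← hg (-(i + p'))]; congr 1; ring
  funext i
  simpa using congrFun key (-i)

section RaysOfPoint

variable {β : Type*}

/-- The left ray of `y` that ends just before coordinate `i`. -/
def leftOf (y : ℤ → β) (i : ℤ) : ℕ → β := fun n => y (i - 1 - n)

/-- The right ray of `y` that starts just after coordinate `i`. -/
def rightOf (y : ℤ → β) (i : ℤ) : ℕ → β := fun n => y (i + 1 + n)

theorem leftOf_succ (y : ℤ → β) (i : ℤ) : leftOf y (i + 1) = consRay (y i) (leftOf y i) := by
  funext n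
  rcases n with _ | n
  · simp [leftOf, consRay]
  · simp only [leftOf, consRay]
    congr 1
    push_cast
    ring

theorem rightOf_eq (y : ℤ → β) (i : ℤ) : rightOf y i = consRay (y (i + 1)) (rightOf y (i + 1)) := by
  funext n
  rcases n with _ | n
  · simp [rightOf, consRay]
  · simp only [rightOf, consRay]
    congr 1
    push_cast
    ring

theorem joinRays_leftOf (y : ℤ → β) (i : ℤ) :
    joinRays (leftOf y i) (consRay (y i) (rightOf y i)) = fun j => y (j + i) := by
  funext j
  rcases j with n | n
  · rcases n with _ | n
    · simp [joinRays, consRay]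
    · simp only [joinRays, consRay, rightOf]
      congr 1
      rw [Int.ofNat_eq_natCast]
      push_cast
      ring
  · simp only [joinRays, leftOf]
    congr 1
    omega

end RaysOfPoint

section Rays

variable {β : Type*} [TopologicalSpace β] {Y : Subshift β ℤ}

/-- The two sequences differ by a shift of one coordinate. -/
theorem joinRays_consRay_mem_iff {a : β} {l ρ : ℕ → β} :
    joinRays (consRay a l) ρ ∈ Y.carrier ↔ joinRays l (consRay a ρ) ∈ Y.carrier := by
  have e1 : (fun i => joinRays l (consRay a ρ) (i + 1)) = joinRays (consRay a l) ρ := by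
    funext i
    rcases i with n | n
    · rfl
    · rcases n with _ | n
      · rfl
      · have : Int.negSucc (n + 1) + 1 = Int.negSucc n := by omega
        simp only [this]
        rfl
  have e2 : (fun i => joinRays (consRay a l) ρ (i + -1)) = joinRays l (consRay a ρ) := by
    rw [← e1]
    simp
  constructor
  · intro h
    rw [← e2]
    exact shift_mem Y (-1) h
  · intro h
    rw [← e1]
    exact shift_mem Y 1 h

theorem right_mem_of_joinRays_mem {l ρ : ℕ → β} (h : joinRays l ρ ∈ Y.carrier) :
    ρ ∈ rightRays Y := ⟨_, h, fun _ => rfl⟩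

theorem left_mem_of_joinRays_mem {l ρ : ℕ → β} (h : joinRays l ρ ∈ Y.carrier) :
    l ∈ leftRays Y := by
  refine ⟨_, shift_mem Y (-1) h, fun n => ?_⟩
  have : -(n : ℤ) + -1 = Int.negSucc n := by omega
  rw [this]
  rfl

theorem future_consRay (a : β) (l : ℕ → β) :
    future Y (consRay a l) = followSet Y (future Y l) a := by
  ext ρ
  simp only [future, followSet, Set.mem_ofPred_eq, joinRays_consRay_mem_iff]
  exact ⟨fun h => ⟨h.1, right_mem_of_joinRays_mem h.2, h.2⟩, fun h => ⟨h.1, h.2.2⟩⟩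

theorem past_consRay (a : β) (ρ : ℕ → β) :
    past Y (consRay a ρ) = precedeSet Y (past Y ρ) a := by
  ext l
  simp only [past, precedeSet, Set.mem_ofPred_eq, ← joinRays_consRay_mem_iff]
  exact ⟨fun h => ⟨h.1, left_mem_of_joinRays_mem h.2, h.2⟩, fun h => ⟨h.1, h.2.2⟩⟩

theorem joinRays_leftOf_mem {y : ℤ → β} (hy : y ∈ Y.carrier) (i : ℤ) :
    joinRays (leftOf y i) (consRay (y i) (rightOf y i)) ∈ Y.carrier := by
  rw [joinRays_leftOf]
  exact shift_mem Y i hy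

/-- The joint state of the point `y` at coordinate `i`. -/
def canonicalState {y : ℤ → β} (hy : y ∈ Y.carrier) (i : ℤ) : JointState Y where
  F := future Y (leftOf y i)
  a := y i
  P := past Y (rightOf y i)
  F_future := ⟨_, left_mem_of_joinRays_mem (joinRays_leftOf_mem hy i), rfl⟩
  P_past := ⟨_, right_mem_of_joinRays_mem
    (joinRays_consRay_mem_iff.2 (joinRays_leftOf_mem hy i)), rfl⟩
  a_mem_F := ⟨_, ⟨right_mem_of_joinRays_mem (joinRays_leftOf_mem hy i),
    joinRays_leftOf_mem hy i⟩, rfl⟩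
  a_mem_P := by
    have h := joinRays_consRay_mem_iff.2 (joinRays_leftOf_mem hy i)
    exact ⟨_, ⟨left_mem_of_joinRays_mem h, h⟩, rfl⟩

theorem canonicalState_adj {y : ℤ → β} (hy : y ∈ Y.carrier) (i : ℤ) :
    (canonicalState hy i).Adj (canonicalState hy (i + 1)) := by
  constructor
  · simp only [canonicalState, leftOf_succ, future_consRay]
  · simp only [canonicalState]
    rw [rightOf_eq, past_consRay]

theorem canonicalState_add {y : ℤ → β} (hy : y ∈ Y.carrier) {N : ℤ}
    (h : ∀ i, y (i + N) = y i) (i : ℤ) :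
    canonicalState hy (i + N) = canonicalState hy i := by
  have hl : leftOf y (i + N) = leftOf y i := funext fun n => by
    simp only [leftOf]
    rw [← h (i - 1 - n)]
    congr 1
    ring
  have hr : rightOf y (i + N) = rightOf y i := funext fun n => by
    simp only [rightOf]
    rw [← h (i + 1 + n)]
    congr 1
    ring
  ext1
  · simp [canonicalState, hl]
  · exact h i
  · simp [canonicalState, hr]

theorem canonicalState_reflect (τ : OneBlockFlip Y) {y : ℤ → β} (hy : y ∈ Y.carrier) {c : ℤ}
    (h : ∀ i, y (c - i) = τ.symbol (y i)) (i : ℤ) :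
    (canonicalState hy (c - i)).star τ = canonicalState hy i := by
  have hl : τ.starRay (rightOf y (c - i)) = leftOf y i := funext fun n => by
    simp only [leftOf, rightOf, OneBlockFlip.starRay]
    rw [← h]
    congr 1
    ring
  have hr : τ.starRay (leftOf y (c - i)) = rightOf y i := funext fun n => by
    simp only [leftOf, rightOf, OneBlockFlip.starRay]
    rw [← h]
    congr 1
    ring
  ext1
  · simp only [canonicalState, JointState.star, τ.image_past, hl]
  · simp [canonicalState, JointState.star, h, τ.invol]
  · simp only [canonicalState, JointState.star, τ.image_future, hr]

theorem JointState.star_star (τ : OneBlockFlip Y) (s : JointState Y) :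
    (s.star τ).star τ = s := by
  ext1
  · simp [JointState.star, Set.image_image, τ.starRay_starRay]
  · exact τ.invol _
  · simp [JointState.star, Set.image_image, τ.starRay_starRay]

theorem starRay_consRay (τ : OneBlockFlip Y) (a : β) (r : ℕ → β) :
    τ.starRay (consRay a r) = consRay (τ.symbol a) (τ.starRay r) := by
  funext n
  rcases n with _ | n <;> rfl

theorem mem_image_starRay_iff (τ : OneBlockFlip Y) {r : ℕ → β} {A : Set (ℕ → β)} :
    r ∈ τ.starRay '' A ↔ τ.starRay r ∈ A := by
  constructor
  · rintro ⟨s, hs, rfl⟩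
    rwa [τ.starRay_starRay]
  · exact fun h => ⟨_, h, τ.starRay_starRay r⟩

theorem image_followSet (τ : OneBlockFlip Y) (A : Set (ℕ → β)) (a : β) :
    τ.starRay '' followSet Y A a = precedeSet Y (τ.starRay '' A) (τ.symbol a) := by
  ext r
  rw [mem_image_starRay_iff]
  simp only [followSet, precedeSet, Set.mem_ofPred_eq, mem_image_starRay_iff, starRay_consRay,
    τ.invol]
  refine and_congr_left fun _ => ⟨fun h => ?_, τ.starRay_mem_rightRays⟩
  simpa only [τ.starRay_starRay] using τ.starRay_mem_leftRays h

theorem image_precedeSet (τ : OneBlockFlip Y) (A : Set (ℕ → β)) (a : β) :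
    τ.starRay '' precedeSet Y A a = followSet Y (τ.starRay '' A) (τ.symbol a) := by
  ext r
  rw [mem_image_starRay_iff]
  simp only [followSet, precedeSet, Set.mem_ofPred_eq, mem_image_starRay_iff, starRay_consRay,
    τ.invol]
  refine and_congr_left fun _ => ⟨fun h => ?_, τ.starRay_mem_leftRays⟩
  simpa only [τ.starRay_starRay] using τ.starRay_mem_rightRays h

theorem JointState.Adj.star (τ : OneBlockFlip Y) {s t : JointState Y} (h : s.Adj t) :
    (t.star τ).Adj (s.star τ) := by
  refine ⟨?_, ?_⟩
  · simp only [JointState.star, h.2, image_precedeSet]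
  · simp only [JointState.star, h.1, image_followSet]

/-- The transition from `v i` to `w (i + 1)` gives equal futures at `i + 1` and equal pasts at `i`.
With equal labels, futures then agree to the right and pasts to the left; periodicity extends both
agreements to all coordinates. -/
theorem jointState_resolving : Resolving (JointState.a (X := Y)) JointState.Adj := by
  rintro v w ⟨hv, ⟨p, hp, hvp⟩, -⟩ ⟨hw, ⟨p', hp', hwp⟩, -⟩ hlab i hi
  have hF : (fun j => (v j).F) = fun j => (w j).F := by
    refine eq_of_periodic_of_eventually_eq hp hp' (fun j => by rw [hvp]) (fun j => by rw [hwp])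
      (i₀ := i + 1) fun j hj => ?_
    induction j, hj using Int.leInduction with
    | base => rw [hi.1, (hv i).1]
    | succ j _ ih => rw [(hv j).1, (hw j).1, ih, hlab]
  have hP : (fun j => (v j).P) = fun j => (w j).P := by
    refine eq_of_periodic_of_eventually_eq_left hp hp' (fun j => by rw [hvp]) (fun j => by rw [hwp])
      (i₀ := i) fun j hj => ?_
    induction j, hj using Int.leInductionDown with
    | base => rw [hi.2, (hw i).2]
    | pred j _ ih =>
      have h1 := (hv (j - 1)).2
      have h2 := (hw (j - 1)).2
      rw [sub_add_cancel] at h1 h2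
      rw [h1, h2, ih, hlab]
  funext j
  exact JointState.ext (congrFun hF j) (hlab j) (congrFun hP j)

/-- Since the future at `j + 1` is the follower set of the one at `j`, the label at `j` can be
prepended to a ray of the former. Only finite prefixes are controlled, because the ray depends on
`n`. -/
theorem exists_mem_F_of_path {v : ℤ → JointState Y} (hv : ∀ i, (v i).Adj (v (i + 1))) (n : ℕ)
    (j : ℤ) : ∃ ρ ∈ (v j).F, ∀ m : ℕ, m < n → ρ m = (v (j + m)).a := by
  induction n generalizing j with
  | zero =>
    obtain ⟨ρ, hρ, -⟩ := (v j).a_mem_F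
    exact ⟨ρ, hρ, fun m hm => absurd hm (Nat.not_lt_zero m)⟩
  | succ n ih =>
    obtain ⟨ρ, hρ, h⟩ := ih (j + 1)
    rw [(hv j).1] at hρ
    refine ⟨_, hρ.2, fun m hm => ?_⟩
    rcases m with _ | m
    · simp [consRay]
    · simp only [consRay]
      rw [h m (by omega)]
      congr 2
      push_cast
      ring

/-- Every central block of the label sequence occurs in a point of `Y`, and `Y` is closed and
shift-invariant. -/
theorem label_mem_of_path {v : ℤ → JointState Y} (hv : ∀ i, (v i).Adj (v (i + 1))) :
    (fun i => (v i).a) ∈ Y.carrier := by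
  have h : ∀ M : ℕ, ∃ x ∈ Y.carrier, ∀ i : ℤ, -M ≤ i → i ≤ M → x i = (v i).a := by
    intro M
    obtain ⟨ρ, hρ, h⟩ := exists_mem_F_of_path hv (2 * M + 1) (-M)
    obtain ⟨l, -, hl⟩ := (v (-M)).F_future
    rw [hl] at hρ
    obtain ⟨x, hx, hxρ⟩ := hρ.1
    refine ⟨_, shift_mem Y M hx, fun i h0 h1 => ?_⟩
    obtain ⟨m, hm⟩ := Int.eq_ofNat_of_zero_le (show 0 ≤ i + M by omega)
    rw [hm, ← hxρ, h m (by omega)]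
    congr 2
    omega
  choose x hx hxv using h
  refine Y.isClosed.mem_of_tendsto (b := Filter.atTop) (f := x) ?_ (Filter.Eventually.of_forall hx)
  rw [tendsto_pi_nhds]
  intro i
  refine tendsto_const_nhds.congr' ?_
  filter_upwards [Filter.eventually_ge_atTop i.natAbs] with M hM
  exact (hxv M i (by omega) (by omega)).symm

/-! ### Finiteness -/

/-- `Ql l` collects the graph vertices at which a walk labelled `l` can end, and `Qr ρ` those at
which a walk labelled `ρ` can start. Thus futures and pasts depend only on subsets of a finite set.
-/
theorem exists_factorization (hY : IsSofic Y) :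
    ∃ (V : Type) (_ : Finite V) (Ql Qr : (ℕ → β) → Set V),
      ∀ l ρ, joinRays l ρ ∈ Y.carrier ↔ (Ql l ∩ Qr ρ).Nonempty := by
  obtain ⟨V, hV, E, hE⟩ := hY
  refine ⟨V, hV, fun l => {q | ∃ u : ℕ → V, u 0 = q ∧ ∀ n, E (u (n + 1)) (l n) (u n)},
    fun ρ => {q | ∃ u : ℕ → V, u 0 = q ∧ ∀ n, E (u n) (ρ n) (u (n + 1))}, fun l ρ => ?_⟩
  rw [hE]
  constructor
  · rintro ⟨v, hv⟩
    refine ⟨v 0, ⟨fun n => v (-n), by simp, fun n => ?_⟩, fun n => v n, rfl, fun n => hv n⟩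
    have := hv (Int.negSucc n)
    have e : Int.negSucc n + 1 = -(n : ℤ) := by omega
    rw [e] at this
    exact this
  · rintro ⟨q, ⟨u, hu0, hu⟩, u', hu0', hu'⟩
    refine ⟨joinRays (fun n => u (n + 1)) u', fun i => ?_⟩
    rcases i with n | n
    · exact hu' n
    · rcases n with _ | n
      · have := hu 0
        rw [hu0, ← hu0'] at this
        exact this
      · have e : Int.negSucc (n + 1) + 1 = Int.negSucc n := by omega
        rw [e]
        exact hu (n + 1)

theorem finite_jointState [Finite β] (hY : IsSofic Y) : Finite (JointState Y) := by
  obtain ⟨V, _, Ql, Qr, hQ⟩ := exists_factorization hY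
  have hF : (Set.range (future Y)).Finite := by
    refine (Set.finite_range fun A : Set V => {ρ | ρ ∈ rightRays Y ∧ (A ∩ Qr ρ).Nonempty}).subset ?_
    rintro _ ⟨l, rfl⟩
    exact ⟨Ql l, by simp only [future, hQ]⟩
  have hP : (Set.range (past Y)).Finite := by
    refine (Set.finite_range fun A : Set V => {l | l ∈ leftRays Y ∧ (Ql l ∩ A).Nonempty}).subset ?_
    rintro _ ⟨ρ, rfl⟩
    exact ⟨Qr ρ, by simp only [past, hQ]⟩
  have := hF.to_subtype
  have := hP.to_subtype
  refine Finite.of_injective (β := Set.range (future Y) × β × Set.range (past Y))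
    (fun s => (⟨s.F, s.F_future.elim fun l h => ⟨l, h.2.symm⟩⟩, s.a,
      ⟨s.P, s.P_past.elim fun ρ h => ⟨ρ, h.2.symm⟩⟩)) fun s t h => ?_
  simp only [Prod.mk.injEq, Subtype.mk.injEq] at h
  exact JointState.ext h.1 h.2.1 h.2.2

end Rays

/-! ## Counting points of a shift space -/

theorem FlipConjugate.numPeriodic_eq {X X' : Type*} [TopologicalSpace X] [TopologicalSpace X']
    {T F : X ≃ₜ X} {T' F' : X' ≃ₜ X'} (h : FlipConjugate T F T' F') (m : ℕ) :
    numPeriodic T' m = numPeriodic T m := by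
  obtain ⟨θ, hT, -⟩ := h
  have hpow : ∀ x, θ ((T ^ m) x) = (T' ^ m) (θ x) := by
    induction m with
    | zero => intro x; simp
    | succ m ih => intro x; rw [pow_succ', pow_succ', Homeomorph.mul_apply, Homeomorph.mul_apply, hT, ih]
  rw [numPeriodic, numPeriodic, ← Set.ncard_image_of_injective _ θ.injective]
  congr 1
  ext x
  constructor
  · intro hx
    refine ⟨θ.symm x, θ.injective ?_, θ.apply_symm_apply x⟩
    rw [hpow, θ.apply_symm_apply]
    exact hx
  · rintro ⟨y, hy, rfl⟩
    show (T' ^ m) (θ y) = θ y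
    rw [← hpow, show (T ^ m) y = y from hy]

theorem FlipConjugate.numFlipFixed_eq {X X' : Type*} [TopologicalSpace X] [TopologicalSpace X']
    {T F : X ≃ₜ X} {T' F' : X' ≃ₜ X'} (h : FlipConjugate T F T' F') (m n : ℕ) :
    numFlipFixed T' F' m n = numFlipFixed T F m n := by
  obtain ⟨θ, hT, hF⟩ := h
  have hpow : ∀ (m : ℕ) x, θ ((T ^ m) x) = (T' ^ m) (θ x) := by
    intro m
    induction m with
    | zero => intro x; simp
    | succ m ih => intro x; rw [pow_succ', pow_succ', Homeomorph.mul_apply, Homeomorph.mul_apply, hT, ih]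
  simp only [numFlipFixed, zpow_natCast]
  rw [← Set.ncard_image_of_injective _ θ.injective]
  congr 1
  ext x
  constructor
  · rintro ⟨h1, h2⟩
    refine ⟨θ.symm x, ⟨θ.injective ?_, θ.injective ?_⟩, θ.apply_symm_apply x⟩
    · rw [hpow, θ.apply_symm_apply, h1]
    · rw [hpow, hF, θ.apply_symm_apply, h2]
  · rintro ⟨y, ⟨h1, h2⟩, rfl⟩
    refine ⟨?_, ?_⟩
    · rw [← hpow, h1]
    · rw [← hF, ← hpow, h2]

section Counting

variable {β : Type*} [TopologicalSpace β] {Y : Subshift β ℤ}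

theorem shiftMap_pow_apply (m : ℕ) (y : Y.carrier) (i : ℤ) :
    ((shiftMap Y ^ m) y).1 i = y.1 (i + m) := by
  induction m generalizing i with
  | zero => simp
  | succ m ih =>
    rw [pow_succ', Homeomorph.mul_apply]
    show ((shiftMap Y ^ m) y).1 (i + 1) = _
    rw [ih]
    exact congrArg y.1 (by push_cast; ring)

theorem shiftMap_zpow_apply (j : ℤ) (y : Y.carrier) (i : ℤ) :
    ((shiftMap Y ^ j) y).1 i = y.1 (i + j) := by
  obtain ⟨m, rfl | rfl⟩ := j.eq_nat_or_neg
  · rw [zpow_natCast, shiftMap_pow_apply]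
  · have h := shiftMap_pow_apply m ((shiftMap Y ^ (-(m : ℤ))) y) (i - m)
    rw [← zpow_natCast, ← Homeomorph.mul_apply, ← zpow_add, add_neg_cancel, sub_add_cancel] at h
    rw [← h]
    rfl

theorem numPeriodic_shiftMap (m : ℕ) :
    numPeriodic (shiftMap Y) m = (periodicIn Y.carrier m).ncard := by
  rw [numPeriodic, ← Set.ncard_image_of_injective _ Subtype.val_injective]
  congr 1
  ext y
  constructor
  · rintro ⟨y, hy, rfl⟩
    refine ⟨y.2, fun i => ?_⟩
    rw [← shiftMap_pow_apply, show (shiftMap Y ^ m) y = y from hy]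
  · rintro ⟨hy, h⟩
    refine ⟨⟨y, hy⟩, Subtype.ext (funext fun i => ?_), rfl⟩
    rw [shiftMap_pow_apply]
    exact h i

/-- Being fixed by `σ^n φ_τ` is symmetry under `i ↦ -n - i`; composing with the period `m` gives the
second reflection `i ↦ m - n - i`. -/
theorem numFlipFixed_shiftMap [DiscreteTopology β] (τ : OneBlockFlip Y) (m : ℕ) (n : ℤ) :
    numFlipFixed (shiftMap Y) τ.flip m n =
      (reflectedIn τ.symbol Y.carrier (-n) (m - n)).ncard := by
  rw [numFlipFixed, ← Set.ncard_image_of_injective _ Subtype.val_injective]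
  have hflip : ∀ (y : Y.carrier) i, (τ.flip y).1 i = τ.symbol (y.1 (-i)) := fun _ _ => rfl
  congr 1
  ext y
  constructor
  · rintro ⟨y, ⟨h1, h2⟩, rfl⟩
    have h3 : ∀ i, y.1 (-n - i) = τ.symbol (y.1 i) := fun i => by
      have := congrFun (congrArg Subtype.val h2) i
      rw [shiftMap_zpow_apply, hflip] at this
      rw [← this, τ.invol]
      exact congrArg y.1 (by ring)
    refine ⟨y.2, h3, fun i => ?_⟩
    have := congrFun (congrArg Subtype.val h1) (-n - i)
    rw [shiftMap_pow_apply] at this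
    rw [← h3, ← this]
    exact congrArg y.1 (by ring)
  · intro hy
    refine ⟨⟨y, hy.1⟩, ⟨Subtype.ext (funext fun i => ?_), Subtype.ext (funext fun i => ?_)⟩, rfl⟩
    · rw [shiftMap_pow_apply]
      have := apply_add_of_mem_reflectedIn τ.invol hy i
      simpa using this
    · rw [shiftMap_zpow_apply, hflip]
      show τ.symbol (y (-(i + n))) = y i
      rw [show -(i + n) = -n - i by ring, hy.2.1, τ.invol]

theorem numPeriodic_formula [Fintype (JointState Y)] [LinearOrder (JointState Y)] {m : ℕ}
    (hm : 1 ≤ m) : (numPeriodic (shiftMap Y) m : ℤ) =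
      ∑ k ∈ Finset.Icc 1 (Fintype.card (JointState Y)), (-1) ^ (k + 1) *
        (kriegerA Y k ^ m).trace := by
  obtain ⟨n, rfl⟩ := Nat.exists_eq_add_of_le' hm
  rw [numPeriodic_shiftMap]
  refine (trace_formula jointState_resolving (fun v hv => label_mem_of_path hv) n
    fun y hy => ?_).symm
  exact ⟨canonicalState hy.1, canonicalState_adj hy.1, canonicalState_add hy.1 hy.2, fun _ => rfl⟩

theorem numFlipFixed_formula [DiscreteTopology β] [Fintype (JointState Y)]
    [LinearOrder (JointState Y)] (τ : OneBlockFlip Y) {m : ℕ} (hm : 1 ≤ m) {c : ℤ} (n : ℕ)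
    (hn : (m : ℤ) + c = 2 * n → 0 < n)
    (L R : ∀ k, Matrix (LabelSets (JointState.a (X := Y)) k) (LabelSets (JointState.a (X := Y)) k) ℤ)
    (hL : c = 0 ∧ (∀ k, L k = kriegerJ τ k) ∨ c = -1 ∧ ∀ k, L k = kriegerJ τ k * kriegerA Y k)
    (hR : (m : ℤ) + c = 2 * n ∧ (∀ k, R k = kriegerJ τ k) ∨
      (m : ℤ) + c = 2 * n + 1 ∧ ∀ k, R k = kriegerA Y k * kriegerJ τ k) :
    (numFlipFixed (shiftMap Y) τ.flip m (-c) : ℤ) =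
      ∑ k ∈ Finset.Icc 1 (Fintype.card (JointState Y)), (-1) ^ (k + 1) *
        entrySum (diagPart (L k) * kriegerB Y k ^ n * diagPart (R k)) := by
  rw [numFlipFixed_shiftMap, neg_neg, sub_neg_eq_add]
  refine (flip_formula (lab := JointState.a) (star := JointState.star τ) (τ := τ.symbol)
    (c := c) (d := m + c) (JointState.star_star τ) (fun _ => rfl) (fun _ _ h => h.star τ) τ.invol
    jointState_resolving (fun v hv => label_mem_of_path hv) (by omega) n hn (fun y hy => ?_) L R
    hL hR).symm
  exact ⟨canonicalState hy.1, canonicalState_adj hy.1, canonicalState_reflect τ hy.1 hy.2.1,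
    canonicalState_reflect τ hy.1 hy.2.2, fun _ => rfl⟩

end Counting

/-! ## The one-block model -/

/-- Vertex sets in `IsSofic` live in `Type`; relabelling by `Fin n` admits any universe. -/
theorem isSofic_of_presentation {β : Type*} [TopologicalSpace β] {Y : Subshift β ℤ} {V : Type*}
    [Finite V] (E : V → β → V → Prop)
    (h : Y.carrier = {x | ∃ v : ℤ → V, ∀ i, E (v i) (x i) (v (i + 1))}) : IsSofic Y := by
  obtain ⟨n, ⟨e⟩⟩ := Finite.exists_equiv_fin V
  refine ⟨Fin n, inferInstance, fun p a q => E (e.symm p) a (e.symm q), ?_⟩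
  rw [h]
  ext x
  constructor
  · rintro ⟨v, hv⟩
    exact ⟨fun i => e (v i), fun i => by simpa using hv i⟩
  · rintro ⟨v, hv⟩
    exact ⟨fun i => e.symm (v i), hv⟩

section Model

variable {α : Type u} [TopologicalSpace α] {X : Subshift α ℤ}

theorem compactSpace_subshift [Finite α] (X : Subshift α ℤ) : CompactSpace X.carrier :=
  isCompact_iff_compactSpace.1 X.isClosed.isCompact

/-- The compactness argument of Curtis, Hedlund and Lyndon: if no window sufficed, a nested sequence
of nonempty compact sets would yield two points that agree at every coordinate but have different
images. -/
theorem exists_window [Finite α] [DiscreteTopology α] {γ : Type*} [TopologicalSpace γ] [DiscreteTopology γ]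
    {f : X.carrier → γ} (hf : Continuous f) :
    ∃ M : ℕ, ∀ x x' : X.carrier, (∀ j : ℤ, -M ≤ j → j ≤ M → x.1 j = x'.1 j) → f x = f x' := by
  have := compactSpace_subshift X
  by_contra! h
  let K : ℕ → Set (X.carrier × X.carrier) := fun M =>
    (⋂ j : ℤ, ⋂ _ : -M ≤ j ∧ j ≤ M, {p | p.1.1 j = p.2.1 j}) ∩ {p | f p.1 ≠ f p.2}
  have hcoord : ∀ j : ℤ, IsClosed {p : X.carrier × X.carrier | p.1.1 j = p.2.1 j} := fun j =>
    isClosed_eq ((continuous_apply j).comp (continuous_subtype_val.comp continuous_fst))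
      ((continuous_apply j).comp (continuous_subtype_val.comp continuous_snd))
  have hcl : ∀ M, IsClosed (K M) := fun M => by
    refine IsClosed.inter (isClosed_iInter fun j => isClosed_iInter fun _ => hcoord j) ?_
    exact (isClosed_discrete {q : γ × γ | q.1 ≠ q.2}).preimage
      ((hf.comp continuous_fst).prodMk (hf.comp continuous_snd))
  have hne : ∀ M, (K M).Nonempty := fun M => by
    obtain ⟨x, x', h1, h2⟩ := h M
    refine ⟨(x, x'), ?_, h2⟩
    simp only [Set.mem_iInter]
    exact fun j hj => h1 j hj.1 hj.2
  obtain ⟨p, hp⟩ := IsCompact.nonempty_iInter_of_sequence_nonempty_isCompact_isClosed K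
    (fun M => by
      rintro p ⟨h1, h2⟩
      refine ⟨?_, h2⟩
      simp only [Set.mem_iInter] at h1 ⊢
      exact fun j hj => h1 j ⟨by push_cast; omega, by push_cast; omega⟩)
    hne (hcl 0).isCompact hcl
  rw [Set.mem_iInter] at hp
  refine (hp 0).2 (congrArg f (Subtype.ext (funext fun j => ?_)))
  have := (hp j.natAbs).1
  simp only [Set.mem_iInter] at this
  exact this j ⟨by omega, by omega⟩

/-- The sequence of the pairs `(x_i, φ(x)_{-i})`. -/
def pairCode (φ : X.carrier ≃ₜ X.carrier) (x : X.carrier) : ℤ → α × α :=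
  fun i => (x.1 i, (φ x).1 (-i))

theorem continuous_pairCode (φ : X.carrier ≃ₜ X.carrier) : Continuous (pairCode φ) :=
  continuous_pi fun i =>
    ((continuous_apply i).comp continuous_subtype_val).prodMk
      ((continuous_apply (-i)).comp (continuous_subtype_val.comp φ.continuous))

theorem pairCode_injective (φ : X.carrier ≃ₜ X.carrier) : Function.Injective (pairCode φ) :=
  fun _ _ h => Subtype.ext (funext fun i => congrArg Prod.fst (congrFun h i))

theorem IsFlip.zpow_apply {φ : X.carrier ≃ₜ X.carrier} (hφ : IsFlip (shiftMap X) φ) (j : ℤ)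
    (x : X.carrier) (i : ℤ) : (φ ((shiftMap X ^ j) x)).1 i = (φ x).1 (i - j) := by
  have h : SemiconjBy φ (shiftMap X) (shiftMap X)⁻¹ := Homeomorph.ext hφ.1
  have h1 : φ ((shiftMap X ^ j) x) = ((shiftMap X)⁻¹ ^ j) (φ x) :=
    DFunLike.congr_fun (h.zpow_right j).eq x
  rw [h1, inv_zpow', shiftMap_zpow_apply, sub_eq_add_neg]

theorem pairCode_shift {φ : X.carrier ≃ₜ X.carrier} (hφ : IsFlip (shiftMap X) φ) (j : ℤ)
    (x : X.carrier) (i : ℤ) : pairCode φ ((shiftMap X ^ j) x) i = pairCode φ x (i + j) := by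
  refine Prod.ext (shiftMap_zpow_apply j x i) ?_
  rw [pairCode, hφ.zpow_apply, pairCode, neg_add']

theorem pairCode_flip {φ : X.carrier ≃ₜ X.carrier} (hφ : IsFlip (shiftMap X) φ)
    (x : X.carrier) (i : ℤ) : pairCode φ (φ x) i = (pairCode φ x (-i)).swap := by
  simp [pairCode, hφ.2 x]

/-- The image of the map `x ↦ (x_i, φ(x)_{-i})_i`. -/
def pairShift [Finite α] [DiscreteTopology α] {φ : X.carrier ≃ₜ X.carrier} (hφ : IsFlip (shiftMap X) φ) :
    Subshift (α × α) ℤ where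
  carrier := Set.range (pairCode φ)
  isClosed := by
    have := compactSpace_subshift X
    exact (isCompact_range (continuous_pairCode φ)).isClosed
  mapsTo j := by
    rintro _ ⟨x, rfl⟩
    refine ⟨(shiftMap X ^ j) x, funext fun i => ?_⟩
    rw [pairCode_shift hφ, add_comm]
    rfl

/-- Swapping the two components is a one-block flip of `pairShift`. -/
def pairFlip [Finite α] [DiscreteTopology α] {φ : X.carrier ≃ₜ X.carrier} (hφ : IsFlip (shiftMap X) φ) :
    OneBlockFlip (pairShift hφ) where
  symbol := Prod.swap
  invol := Prod.swap_swap
  maps := by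
    rintro _ ⟨x, rfl⟩
    exact ⟨φ x, funext fun i => pairCode_flip hφ x i⟩

theorem flipConjugate_pairShift [Finite α] [DiscreteTopology α] {φ : X.carrier ≃ₜ X.carrier}
    (hφ : IsFlip (shiftMap X) φ) :
    FlipConjugate (shiftMap (pairShift hφ)) (pairFlip hφ).flip (shiftMap X) φ := by
  have := compactSpace_subshift X
  let e : X.carrier ≃ (pairShift hφ).carrier := Equiv.ofInjective _ (pairCode_injective φ)
  have he : Continuous e := (continuous_pairCode φ).subtype_mk _
  let θ : X.carrier ≃ₜ (pairShift hφ).carrier := he.homeoOfEquivCompactToT2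
  have hθ : ∀ x, (θ x).1 = pairCode φ x := fun _ => rfl
  refine ⟨θ.symm, fun y => ?_, fun y => ?_⟩
  · obtain ⟨x, rfl⟩ := θ.surjective y
    rw [θ.symm_apply_apply, θ.symm_apply_eq]
    refine Subtype.ext (funext fun i => ?_)
    have := pairCode_shift hφ 1 x i
    rw [zpow_one] at this
    rw [hθ, this]
    rfl
  · obtain ⟨x, rfl⟩ := θ.surjective y
    rw [θ.symm_apply_apply, θ.symm_apply_eq]
    refine Subtype.ext (funext fun i => ?_)
    rw [hθ, pairCode_flip hφ]
    rfl

/-- By `exists_window`, `φ(x)_{-i}` depends only on the block of `x` around coordinate `i`. A graph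
whose vertices also remember this block presents the pair shift. -/
theorem isSofic_pairShift [Finite α] [DiscreteTopology α] (hX : IsSofic X) {φ : X.carrier ≃ₜ X.carrier}
    (hφ : IsFlip (shiftMap X) φ) : IsSofic (pairShift hφ) := by
  obtain ⟨V, _, E, hE⟩ := hX
  obtain ⟨M, hM⟩ := exists_window (f := fun x : X.carrier => (φ x).1 0)
    ((continuous_apply 0).comp (continuous_subtype_val.comp φ.continuous))
  let o : Set.Icc (-(M : ℤ)) M := ⟨0, by simp⟩
  -- An edge advances the graph of `X` by the central symbol, slides the block by one place, and is
  -- labelled by that symbol together with the value of `φ` on some point of `X` that carries the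
  -- block.
  refine isSofic_of_presentation (V := V × (Set.Icc (-(M : ℤ)) M → α))
    (fun s c t => E s.1 (s.2 o) t.1 ∧ (∀ j j' : Set.Icc (-(M : ℤ)) M, j'.1 = j.1 + 1 →
      t.2 j = s.2 j') ∧ s.2 o = c.1 ∧
      ∃ x : X.carrier, (∀ j, x.1 j.1 = s.2 j) ∧ (φ x).1 0 = c.2) ?_
  ext y
  constructor
  · rintro ⟨x, rfl⟩
    obtain ⟨v, hv⟩ := hE.subset x.2
    refine ⟨fun i => (v i, fun j => x.1 (i + j)), fun i => ⟨by simpa [o] using hv i, ?_,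
      by simp [o, pairCode], (shiftMap X ^ i) x, fun j => ?_, ?_⟩⟩
    · intro j j' h
      simp only [h]
      exact congrArg x.1 (by ring)
    · rw [shiftMap_zpow_apply, add_comm]
    · rw [hφ.zpow_apply, zero_sub]
      rfl
  · rintro ⟨v, hv⟩
    let x : ℤ → α := fun i => (v i).2 o
    have hx : x ∈ X.carrier := by
      rw [hE]
      exact ⟨fun i => (v i).1, fun i => (hv i).1⟩
    have hpos : ∀ (n : ℕ) (hn : (n : ℤ) ∈ Set.Icc (-(M : ℤ)) M) (i : ℤ),
        (v i).2 ⟨n, hn⟩ = x (i + n) := by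
      intro n
      induction n with
      | zero => intro hn i; simp [x, o]
      | succ n ih =>
        intro hn i
        have hn' : (n : ℤ) ∈ Set.Icc (-(M : ℤ)) M := ⟨by omega, by have := hn.2; push_cast at this; omega⟩
        rw [← (hv i).2.1 ⟨n, hn'⟩ ⟨_, hn⟩ (by push_cast; rfl), ih hn']
        congr 1
        push_cast
        ring
    have hneg : ∀ (n : ℕ) (hn : -(n : ℤ) ∈ Set.Icc (-(M : ℤ)) M) (i : ℤ),
        (v i).2 ⟨-n, hn⟩ = x (i + -n) := by
      intro n
      induction n with
      | zero => intro hn i; simp [x, o]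
      | succ n ih =>
        intro hn i
        have hn' : -(n : ℤ) ∈ Set.Icc (-(M : ℤ)) M := ⟨by have := hn.1; push_cast at this; omega, by omega⟩
        have h1 := (hv (i - 1)).2.1 ⟨_, hn⟩ ⟨_, hn'⟩ (by push_cast; ring)
        rw [sub_add_cancel] at h1
        rw [h1, ih hn']
        congr 1
        push_cast
        ring
    -- The overlap conditions, followed outward from the centre, make all remembered blocks windows
    -- of the single sequence `x`.
    have hwin : ∀ (i : ℤ) (j : Set.Icc (-(M : ℤ)) M), (v i).2 j = x (i + j) := by
      rintro i ⟨j, hj⟩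
      obtain ⟨n, rfl | rfl⟩ := j.eq_nat_or_neg
      · exact hpos n hj i
      · exact hneg n hj i
    refine ⟨⟨x, hx⟩, funext fun i => Prod.ext (hv i).2.2.1 ?_⟩
    obtain ⟨-, -, -, x', hx', hb⟩ := hv i
    rw [← hb]
    show (φ ⟨x, hx⟩).1 (-i) = _
    rw [← zero_sub, ← hφ.zpow_apply]
    refine hM _ _ fun j h0 h1 => ?_
    rw [shiftMap_zpow_apply]
    show x (j + i) = _
    rw [hx' ⟨j, h0, h1⟩, hwin, add_comm]

end Model

end

/-! ### The theorem -/

theorem theoremB {α : Type u} [Fintype α] [TopologicalSpace α] [DiscreteTopology α]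
    (X : Subshift α ℤ) (hX : IsSofic X)
    (φ : X.carrier ≃ₜ X.carrier) (hφ : IsFlip (shiftMap X) φ) :
    -- there is a conjugate sofic shift with a one-block flip
    (∃ (β : Type u) (_ : Fintype β) (_ : TopologicalSpace β) (_ : DiscreteTopology β)
        (Y : Subshift β ℤ) (τ : OneBlockFlip Y), IsOneBlockModel φ τ) ∧
    -- and the matrices of the joint state chain of any such system satisfy the four formulas
    (∀ (β : Type u) [Fintype β] [TopologicalSpace β] [DiscreteTopology β]
        (Y : Subshift β ℤ) (τ : OneBlockFlip Y), IsOneBlockModel φ τ →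
      Finite (JointState Y) ∧
      ∀ [Fintype (JointState Y)] [LinearOrder (JointState Y)] (m : ℕ), 1 ≤ m →
        ((numPeriodic (shiftMap X) m : ℤ) =
          ∑ k ∈ Finset.Icc 1 (Fintype.card (JointState Y)), (-1) ^ (k + 1) *
            (kriegerA Y k ^ m).trace) ∧
        ((numFlipFixed (shiftMap X) φ (2 * m) 0 : ℤ) =
          ∑ k ∈ Finset.Icc 1 (Fintype.card (JointState Y)), (-1) ^ (k + 1) *
            entrySum (diagPart (kriegerJ τ k) * kriegerB Y k ^ m * diagPart (kriegerJ τ k))) ∧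
        ((numFlipFixed (shiftMap X) φ (2 * m) 1 : ℤ) =
          ∑ k ∈ Finset.Icc 1 (Fintype.card (JointState Y)), (-1) ^ (k + 1) *
            entrySum (diagPart (kriegerJ τ k * kriegerA Y k) * kriegerB Y k ^ (m - 1) *
              diagPart (kriegerA Y k * kriegerJ τ k))) ∧
        ((numFlipFixed (shiftMap X) φ (2 * m - 1) 0 : ℤ) =
          ∑ k ∈ Finset.Icc 1 (Fintype.card (JointState Y)), (-1) ^ (k + 1) *
            entrySum (diagPart (kriegerJ τ k) * kriegerB Y k ^ (m - 1) *
              diagPart (kriegerA Y k * kriegerJ τ k)))) := by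
  refine ⟨⟨α × α, inferInstance, inferInstance, inferInstance, pairShift hφ, pairFlip hφ,
    isSofic_pairShift hX hφ, flipConjugate_pairShift hφ⟩, ?_⟩
  intro β _ _ _ Y τ ⟨hY, hconj⟩
  refine ⟨finite_jointState hY, fun m hm => ⟨?_, ?_, ?_, ?_⟩⟩
  · rw [hconj.numPeriodic_eq, numPeriodic_formula hm]
  · have h := hconj.numFlipFixed_eq (2 * m) 0
    rw [Nat.cast_zero] at h
    rw [h, ← neg_zero]
    exact numFlipFixed_formula τ (by omega) m (fun _ => hm) (kriegerJ τ) (kriegerJ τ)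
      (Or.inl ⟨rfl, fun _ => rfl⟩) (Or.inl ⟨by push_cast; ring, fun _ => rfl⟩)
  · have h := hconj.numFlipFixed_eq (2 * m) 1
    rw [Nat.cast_one] at h
    rw [h, ← neg_neg (1 : ℤ)]
    -- Here `c = -1` and `d = 2 * m - 1 = 2 * (m - 1) + 1`: both mirrors lie on edges, so `A` enters
    -- at both ends.
    exact numFlipFixed_formula τ (by omega) (m - 1) (by omega)
      (fun k => kriegerJ τ k * kriegerA Y k) (fun k => kriegerA Y k * kriegerJ τ k)
      (Or.inr ⟨rfl, fun _ => rfl⟩) (Or.inr ⟨by omega, fun _ => rfl⟩)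
  · have h := hconj.numFlipFixed_eq (2 * m - 1) 0
    rw [Nat.cast_zero] at h
    rw [h, ← neg_zero]
    -- One mirror lies on the vertex at time `0`, the other on the edge from `m - 1` to `m`.
    exact numFlipFixed_formula τ (by omega) (m - 1) (by omega) (kriegerJ τ)
      (fun k => kriegerA Y k * kriegerJ τ k)
      (Or.inl ⟨rfl, fun _ => rfl⟩) (Or.inr ⟨by omega, fun _ => rfl⟩)
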